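/- **Setting.** Let $X$ be a Polish space with a $\sigma$-finite Borel measure $m$ of full support, and let $\mathcal E:L^2(m)\to[0,\infty]$ be a symmetric, densely defined, strongly local Dirichlet form with domain $\mathbb V=\{\mathcal E<\infty\}$, $\|f\|_{\mathbb V}^2=\|f\|_2^2+\mathcal E(f)$; that is, $\mathcal E$ is a lower semicontinuous quadratic form, $\mathcal E(\theta\circ f)\le\mathcal E(f)$ for every $1$-Lipschitz $\theta:\mathbb R\to\mathbb R$ with $\theta(0)=0$, and (for the associated bilinear form) $\mathcal E(f,g)=0$ whenever $f,g\in\mathbb V$ and $(f+a)g=0$ a.e. for some $a\in\mathbb R$. Assume that it has a carré du champ: for each $f\in\mathbb V$ there is $\Gamma(f)\in L^1(m)$, $\Gamma(f)\ge0$, which is the density of the linear form $\varphi\mapsto\mathcal E(f,f\varphi)-\tfrac12\mathcal E(f^2,\varphi)$, $\varphi\in\mathbb V\cap L^\infty$ (defined for $f\in\mathbb V\cap L^\infty$ and extended by continuity to $f\in\mathbb V$). Let $\mathscr A\subset\mathbb V\cap\bigcap_{p\in[1,\infty]}L^p(m)$ be a linear subspace dense in $\mathbb V$, with $\Gamma(f)\in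 L^\infty(m)$ for all $f\in\mathscr A$, and such that $\Phi(f_1,\dots,f_n)\in\mathscr A$ whenever $f_i\in\mathscr A$, $\Phi\in C^1(\mathbb R^n)$ and $\Phi(0)=0$. A *derivation* $b$ is a linear map $f\mapsto df(b)$ from $\mathscr A$ to the space $L^0(m)$ of classes of a.e. finite Borel functions, with $d(fg)(b)=f\,dg(b)+g\,df(b)$ and $|df(b)|\le g\sqrt{\Gamma(f)}$ a.e. for all $f\in\mathscr A$, for some $g\in L^0(m)$; the smallest such $g$ is $|b|$. Let $T\in(0,\infty)$ and let $(b_t)_{t\in(0,T)}$ be a Borel family of derivations (i.e. there is a Borel $g:(0,T)\times X\to[0,\infty)$ with $|b_t|\le g(t,\cdot)$ $m$-a.e. for a.e. $t$; the smallest such $g$ is denoted $|b|$). Fix Borel representatives of all $f\in\mathscr A$ and of all maps $(t,x)\mapsto df(b_t)(x)$, $f\in\mathscr A$. Let $\mathcal L_+$ be the class of all $u\in L^\infty_t(L^1_x\cap L^\infty_x)$, $u\ge0$, such that $t\mapsto u_t$ is weakly continuous on $[0,T]$ in duality with $\mathscr A$. Such a $u$ solves the continuity equation $\partial_tu_t+\operatorname{div}(u_tb_t)=0$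 with initial datum $\bar u$ if $$\int_0^T\!\!\int\bigl[-\psi'\varphi-\psi\,d\varphi(b_t)\bigr]u_t\,dm\,dt=\psi(0)\int\varphi\,\bar u\,dm\qquad\text{for all }\varphi\in\mathscr A,\ \psi\in C^1([0,T])\text{ with }\psi(T)=0.$$ Write $e_t:C([0,T];X)\to X$, $e_t(\gamma)=\gamma(t)$. A curve $\gamma\in C([0,T];X)$ solves the ODE $\dot\gamma=b_t(\gamma)$ tested on $f\in\mathscr A$ if $f\circ\gamma\in W^{1,1}(0,T)$ and $(f\circ\gamma)'(t)=df(b_t)(\gamma(t))$ for a.e. $t\in(0,T)$. A Borel probability measure $\eta$ on $C([0,T];X)$ is concentrated on solutions to the ODE if, for every $f\in\mathscr A$, $\eta$-a.e. $\gamma$ solves the ODE tested on $f$. **Theorem 8.4 (No splitting criterion).** Assume that $|b|\in L^1_t(L^1_x+L^\infty_x)$ and that, for every $\bar u\in L^1\cap L^\infty(m)$, the continuity equation with initial datum $\bar u$ has at most one solution in $\mathcal L_+$. Let $\eta$ be a Borel probability measure on $C([0,T];X)$ such that 1. $\eta$ is concentrated on solutions to the ODE $\dot\gamma=b_t(\gamma)$;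 2. there is $L_0\in[0,\infty)$ with $(e_t)_\#\eta\le L_0\,m$ for all $t\in[0,T]$. Then the conditional probability measures $\eta_x$ of $\eta$ induced by the map $e_0$ are Dirac masses for $(e_0)_\#\eta$-a.e. $x$. Equivalently, there is a Borel map $X\ni x\mapsto\gamma_x\in C([0,T];X)$ with $\gamma_x(0)=x$ for all $x$, such that for every $f\in\mathscr A$ the curve $\gamma_x$ solves the ODE tested on $f$ for $(e_0)_\#\eta$-a.e. $x$, and $$\eta=\int\delta_{\gamma_x}\,d(e_0)_\#\eta(x).$$ Both assertions hold. -/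

import Mathlib

open MeasureTheory ProbabilityTheory Set Filter Topology
open scoped ENNReal NNReal

noncomputable section

namespace NoSplitting

variable {X : Type*} [MeasurableSpace X]

/-! ### Symmetric strongly local Dirichlet forms with a carré du champ -/

/-- The product of two classes of functions, as an element of `L²` (and `0` if the product is not
square integrable). -/
def prodL2 {m : Measure X} (f g : Lp ℝ 2 m) : Lp ℝ 2 m :=
  open Classical in
  if h : MemLp (fun x => f x * g x) 2 m then h.toLp _ else 0

/-- The symmetric bilinear form obtained by polarisation from `E : L² → [0, ∞]`; it is meaningful
on the domain `{E < ∞}`. -/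
def polar {m : Measure X} (E : Lp ℝ 2 m → ℝ≥0∞) (f g : Lp ℝ 2 m) : ℝ :=
  ((E (f + g)).toReal - (E (f - g)).toReal) / 4

/-- A symmetric, densely defined, strongly local Dirichlet form on `L²(m)`: a lower semicontinuous
quadratic form with values in `[0, ∞]`, with dense domain, not increased by normal contractions,
and such that `E (f, g) = 0` whenever `(f + a) g = 0` a.e. for some constant `a`. -/
structure DirichletForm (m : Measure X) where
  /-- the quadratic form -/
  E : Lp ℝ 2 m → ℝ≥0∞
  smul : ∀ (c : ℝ) (f : Lp ℝ 2 m), E (c • f) = ENNReal.ofReal (c ^ 2) * E f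
  parallelogram : ∀ f g : Lp ℝ 2 m, E (f + g) + E (f - g) = 2 * E f + 2 * E g
  lsc : LowerSemicontinuous E
  dense : Dense {f : Lp ℝ 2 m | E f < ∞}
  markov : ∀ (θ : ℝ → ℝ) (hθ : LipschitzWith 1 θ) (h0 : θ 0 = 0) (f : Lp ℝ 2 m),
    E (hθ.compLp h0 f) ≤ E f
  stronglyLocal : ∀ f g : Lp ℝ 2 m, E f < ∞ → E g < ∞ →
    (∃ a : ℝ, ∀ᵐ x ∂m, (f x + a) * g x = 0) → polar E f g = 0

namespace DirichletForm

variable {m : Measure X}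

/-- The domain `𝕍` of the form. -/
def dom (𝓔 : DirichletForm m) : Set (Lp ℝ 2 m) := {f | 𝓔.E f < ∞}

/-- The bounded elements of the domain. -/
def bddDom (𝓔 : DirichletForm m) : Set (Lp ℝ 2 m) := {f | 𝓔.E f < ∞ ∧ MemLp f ∞ m}

/-- The square of the norm of `𝕍`. -/
def normSq (𝓔 : DirichletForm m) (f : Lp ℝ 2 m) : ℝ≥0∞ :=
  ENNReal.ofReal (‖f‖ ^ 2) + 𝓔.E f

/-- `Γ[f; φ] = E (f, f φ) - E (f², φ) / 2`, for bounded `f`, `φ` in the domain. -/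
def gammaForm (𝓔 : DirichletForm m) (f φ : Lp ℝ 2 m) : ℝ :=
  polar 𝓔.E f (prodL2 f φ) - polar 𝓔.E (prodL2 f f) φ / 2

end DirichletForm

/-- A carré du champ of a Dirichlet form: for every `f` in the domain, `Γ f ∈ L¹` is nonnegative
and is the density of the linear form `φ ↦ Γ[f; φ]`, the latter being extended by continuity from
the bounded elements of the domain to the whole domain. The values of `Γ` outside the domain are
irrelevant. -/
structure CarreDuChamp {m : Measure X} (𝓔 : DirichletForm m) where
  /-- the carré du champ `f ↦ Γ(f)` -/
  Γ : Lp ℝ 2 m → Lp ℝ 1 m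
  nonneg : ∀ f ∈ 𝓔.dom, 0 ≤ᵐ[m] Γ f
  represents : ∀ f ∈ 𝓔.dom, ∀ F : ℕ → Lp ℝ 2 m, (∀ n, F n ∈ 𝓔.bddDom) →
    Tendsto (fun n => 𝓔.normSq (F n - f)) atTop (𝓝 0) →
    ∀ φ ∈ 𝓔.bddDom,
      Tendsto (fun n => 𝓔.gammaForm (F n) φ) atTop (𝓝 (∫ x, φ x * Γ f x ∂m))

/-! ### The algebra of test functions -/

/-- The standing assumptions on the algebra `A` of test functions: it is a subspace of the domain,
dense in it, contained in every `Lᵖ`, `p ∈ [1, ∞]`, closed under composition with `C¹` functions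
of several variables vanishing at the origin (in particular under products), and `Γ(f)` is
essentially bounded for every `f ∈ A`. -/
structure IsTestAlgebra {m : Measure X} {𝓔 : DirichletForm m} (C : CarreDuChamp 𝓔)
    (A : Submodule ℝ (Lp ℝ 2 m)) : Prop where
  subset_dom : ∀ f ∈ A, f ∈ 𝓔.dom
  memLp : ∀ f ∈ A, ∀ p : ℝ≥0∞, 1 ≤ p → MemLp f p m
  dense : ∀ f ∈ 𝓔.dom, ∀ ε : ℝ≥0∞, 0 < ε → ∃ g ∈ A, 𝓔.normSq (g - f) < ε
  comp : ∀ (n : ℕ) (Φ : (Fin n → ℝ) → ℝ), ContDiff ℝ 1 Φ → Φ 0 = 0 →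
    ∀ f : Fin n → Lp ℝ 2 m, (∀ i, f i ∈ A) →
      ∃ h ∈ A, h =ᵐ[m] fun x => Φ (fun i => f i x)
  gamma_bdd : ∀ f ∈ A, MemLp (C.Γ f) ∞ m

/-! ### Derivations -/

/-- A derivation: a linear map `f ↦ df(b)` from `A` to `L⁰(m)` satisfying the Leibniz rule and a
pointwise bound `|df(b)| ≤ g √Γ(f)` for some `g ∈ L⁰(m)`. -/
structure Deriv {m : Measure X} {𝓔 : DirichletForm m} (C : CarreDuChamp 𝓔)
    (A : Submodule ℝ (Lp ℝ 2 m)) where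
  /-- the action `f ↦ df(b)` -/
  d : A →ₗ[ℝ] (X →ₘ[m] ℝ)
  leibniz : ∀ f g h : A, ((h : Lp ℝ 2 m) =ᵐ[m] fun x => (f : Lp ℝ 2 m) x * (g : Lp ℝ 2 m) x) →
    d h =ᵐ[m] fun x => (f : Lp ℝ 2 m) x * d g x + (g : Lp ℝ 2 m) x * d f x
  bound : ∃ g : X →ₘ[m] ℝ, ∀ f : A, ∀ᵐ x ∂m, |d f x| ≤ g x * √(C.Γ (f : Lp ℝ 2 m) x)

section Families

variable {m : Measure X} {𝓔 : DirichletForm m} {C : CarreDuChamp 𝓔}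
  {A : Submodule ℝ (Lp ℝ 2 m)}

/-- `g : (0,T) × X → [0,∞)` is Borel and `|b_t| ≤ g (t, ·)` a.e. in `X`, for a.e. `t ∈ (0, T)`.
Only the values `b t` with `t ∈ (0, T)` matter. -/
def Dominates (T : ℝ) (b : ℝ → Deriv C A) (g : ℝ × X → ℝ) : Prop :=
  Measurable g ∧ (∀ z, 0 ≤ g z) ∧
    ∀ᵐ t ∂(volume.restrict (Ioo 0 T)), ∀ f : A, ∀ᵐ x ∂m,
      |(b t).d f x| ≤ g (t, x) * √(C.Γ (f : Lp ℝ 2 m) x)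

/-- `g` is (a representative of) `|b|`: the smallest function, up to a.e. equality in
`(0, T) × X`, dominating the family `b`. -/
def IsModulus (T : ℝ) (b : ℝ → Deriv C A) (g : ℝ × X → ℝ) : Prop :=
  Dominates T b g ∧
    ∀ g', Dominates T b g' → ∀ᵐ z ∂((volume.restrict (Ioo 0 T)).prod m), g z ≤ g' z

/-- The space `L¹_t(L¹_x + L^∞_x)` on `(0, T) × X`. -/
def MemL1L1Linf (T : ℝ) (m : Measure X) (g : ℝ × X → ℝ) : Prop :=
  ∃ g₁ g₂ : ℝ × X → ℝ, Measurable g₁ ∧ Measurable g₂ ∧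
    (∀ᵐ t ∂(volume.restrict (Ioo 0 T)), ∀ᵐ x ∂m, g (t, x) = g₁ (t, x) + g₂ (t, x)) ∧
    ∫⁻ t in Ioo 0 T, eLpNorm (fun x => g₁ (t, x)) 1 m < ∞ ∧
    ∫⁻ t in Ioo 0 T, eLpNorm (fun x => g₂ (t, x)) ∞ m < ∞

/-- `b = (b_t)` is a Borel family of derivations with `|b| ∈ L¹_t(L¹_x + L^∞_x)`. -/
def FamilyInL1L1Linf (T : ℝ) (b : ℝ → Deriv C A) : Prop :=
  ∃ g : ℝ × X → ℝ, IsModulus T b g ∧ MemL1L1Linf T m g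

/-- A choice of Borel representatives of the functions `f ∈ A` and of the maps
`(t, x) ↦ df(b_t)(x)`, `f ∈ A`. -/
structure BorelRep (T : ℝ) (b : ℝ → Deriv C A) where
  /-- representative of `f` -/
  fn : A → X → ℝ
  /-- representative of `(t, x) ↦ df(b_t)(x)` -/
  dfn : A → ℝ × X → ℝ
  measurable_fn : ∀ f, Measurable (fn f)
  fn_ae : ∀ f : A, fn f =ᵐ[m] (f : Lp ℝ 2 m)
  measurable_dfn : ∀ f, Measurable (dfn f)
  dfn_ae : ∀ f : A, ∀ᵐ t ∂(volume.restrict (Ioo 0 T)),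
    (fun x => dfn f (t, x)) =ᵐ[m] (b t).d f

/-! ### The continuity equation -/

/-- `u` solves `∂ₜ u + div (u b) = 0` in `(0, T) × X` with initial condition `u₀`, weakly. -/
def SolvesContinuityEq (T : ℝ) (b : ℝ → Deriv C A) (u : ℝ → X → ℝ) (u₀ : X → ℝ) : Prop :=
  ∀ (φ : A) (ψ : ℝ → ℝ), ContDiff ℝ 1 ψ → ψ T = 0 →
    ∫ t in Ioo 0 T, ∫ x, (-(deriv ψ t) * (φ : Lp ℝ 2 m) x - ψ t * (b t).d φ x) * u t x ∂m
      = ψ 0 * ∫ x, (φ : Lp ℝ 2 m) x * u₀ x ∂m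

variable (m A) in
/-- The class `𝓛₊`: functions `u ≥ 0` in `L^∞_t(L¹_x ∩ L^∞_x)` such that `t ↦ u_t` is weakly
continuous in `[0, T]`, in duality with `A`. -/
structure MemLPlus (T : ℝ) (u : ℝ → X → ℝ) : Prop where
  aesm : AEStronglyMeasurable (Function.uncurry u) ((volume.restrict (Ioo 0 T)).prod m)
  memLp_one : ∀ t ∈ Icc 0 T, MemLp (u t) 1 m
  memLp_top : ∀ t ∈ Icc 0 T, MemLp (u t) ∞ m
  bdd : ∃ K : ℝ≥0, ∀ᵐ t ∂(volume.restrict (Ioo 0 T)),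
    eLpNorm (u t) 1 m ≤ K ∧ eLpNorm (u t) ∞ m ≤ K
  nonneg : ∀ t ∈ Icc 0 T, 0 ≤ᵐ[m] u t
  weakCont : ∀ f ∈ A, ContinuousOn (fun t => ∫ x, f x * u t x ∂m) (Icc 0 T)

/-- For every initial datum in `L¹ ∩ L^∞`, the continuity equation has at most one solution in the
class `𝓛₊`. -/
def UniqueInLPlus (T : ℝ) (b : ℝ → Deriv C A) : Prop :=
  ∀ u₀ : X → ℝ, MemLp u₀ 1 m → MemLp u₀ ∞ m →
    ∀ u v : ℝ → X → ℝ, MemLPlus m A T u → MemLPlus m A T v →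
      SolvesContinuityEq T b u u₀ → SolvesContinuityEq T b v u₀ →
        ∀ t ∈ Icc 0 T, u t =ᵐ[m] v t

/-! ### Curves and the ODE -/

/-- `h ∈ W^{1,1}(0, T)` with weak derivative `k`. -/
def HasW11Deriv (T : ℝ) (h k : ℝ → ℝ) : Prop :=
  IntegrableOn h (Ioo 0 T) ∧ IntegrableOn k (Ioo 0 T) ∧
    ∀ ψ : ℝ → ℝ, ContDiff ℝ 1 ψ → HasCompactSupport ψ → tsupport ψ ⊆ Ioo 0 T →
      ∫ t in Ioo 0 T, deriv ψ t * h t = -∫ t in Ioo 0 T, ψ t * k t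

/-- The curve `γ` satisfies the ODE `γ' = b_t(γ)` tested against `f`: `f ∘ γ ∈ W^{1,1}(0, T)` and
`(f ∘ γ)'(t) = df(b_t)(γ(t))` for a.e. `t`. -/
def SolvesODE [TopologicalSpace X] {T : ℝ} (hT : 0 < T) {b : ℝ → Deriv C A} (R : BorelRep T b)
    (f : A) (γ : C(Icc (0 : ℝ) T, X)) : Prop :=
  HasW11Deriv T (fun t => R.fn f (IccExtend hT.le γ t))
    (fun t => R.dfn f (t, IccExtend hT.le γ t))

/-- `η` is concentrated on solutions to the ODE `γ' = b_t(γ)`. -/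
def ConcentratedOnSolutions [TopologicalSpace X] {T : ℝ} (hT : 0 < T) {b : ℝ → Deriv C A}
    (R : BorelRep T b) [MeasurableSpace C(Icc (0 : ℝ) T, X)]
    (η : Measure C(Icc (0 : ℝ) T, X)) : Prop :=
  ∀ f : A, ∀ᵐ γ ∂η, SolvesODE hT R f γ

end Families

/-- The evaluation map `e_t` on `C([0, T]; X)`. -/
def evalAt [TopologicalSpace X] {T : ℝ} (t : Icc (0 : ℝ) T) (γ : C(Icc (0 : ℝ) T, X)) : X := γ t

/-- The initial time, as a point of `[0, T]`. -/
def time0 {T : ℝ} (hT : 0 < T) : Icc (0 : ℝ) T := ⟨0, left_mem_Icc.2 hT.le⟩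

/-- The family of probability measures `x ↦ κ x` consists of the conditional measures of `η`
induced by `e₀`: `η = ∫ κ x d(e₀)_# η(x)`, and `κ x` is concentrated on `{γ(0) = x}` for
`(e₀)_# η`-a.e. `x`. -/
def IsDisintegration [TopologicalSpace X] {T : ℝ} (hT : 0 < T)
    [MeasurableSpace C(Icc (0 : ℝ) T, X)] (η : Measure C(Icc (0 : ℝ) T, X))
    (κ : Kernel X C(Icc (0 : ℝ) T, X)) : Prop :=
  (∀ x, IsProbabilityMeasure (κ x)) ∧
    η = (η.map (evalAt (time0 hT))).bind κ ∧
    ∀ᵐ x ∂(η.map (evalAt (time0 hT))), ∀ᵐ γ ∂(κ x), evalAt (time0 hT) γ = x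

end NoSplitting

end

open scoped InnerProductSpace

/-! Suppose the curves split. Then weighting `η` in two ways that share the same initial marginal
gives two different evolutions of one initial density. Both evolutions solve the continuity equation
in the class `𝓛₊`, which contradicts uniqueness.

Evaluation `g ↦ g(γ_t)` is a bounded operator `L²(m) → L²(η)`, with norm at most the square root of
the marginal bound. For a test function `f`, the map `t ↦ f(γ_t)` agrees for a.e. `t` with an
absolutely continuous function (`pathRep`). By density the operators therefore agree, for a.e. `t`,
with a strongly continuous family `L` (`exists_flowOp`). For a weight `0 ≤ W ≤ 1` in `L²(η)`, the
adjoint of `L` at time `t` applied to `W` is `dualDensity`: it is weakly continuous in `t`, and for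
a.e. `t` it is the density of the time marginal of `W η`. Integrating the ODE against `W η` shows
that it solves the continuity equation (`exists_solution`). Hence two weights whose dual densities
agree at time `0` have the same dual densities at all times (`dualDensity_eq_of_initial_eq`).

Test functions are not assumed continuous on `X`, so the trace `L g` at time `0` need not a priori
be `g(γ_0)`. `flowOp_initial_eq` proves that it is. Continuity of the curves shows that the trace
equals `g(γ_0)` multiplied by the indicator of a set of curves, independent of `g`. A weight carried
by the complement of that set starts from density `0`, so by uniqueness it vanishes.

To conclude, the indicator of `{γ_t ∈ E}` and its conditional expectation given `γ_0` have the same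
initial dual density, hence the same density at time `t`. This forces the conditional probability of
`{γ_t ∈ E}` to be `0` or `1` (`kernel_zero_or_one`). Countably many pairs `(t, E)` separate curves,
so the conditional measures are Dirac masses (`ae_exists_eq_dirac`), and `exists_selection` makes
the choice of curve Borel. -/

namespace NoSplitting


/-! ### Sobolev functions on an interval -/

/-- Integration by parts for a primitive of an integrable function against a `C¹` function. -/
theorem setIntegral_deriv_mul_primitive {T : ℝ} (hT : 0 < T) {k ψ : ℝ → ℝ}
    (hk : IntegrableOn k (Ioo 0 T)) (hψ : ContDiff ℝ 1 ψ) :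
    ∫ t in Ioo 0 T, (deriv ψ t * (∫ r in (0 : ℝ)..t, k r) + ψ t * k t)
      = ψ T * ∫ r in (0 : ℝ)..T, k r := by
  have hki : IntervalIntegrable k volume 0 T :=
    (intervalIntegrable_iff_integrableOn_Ioo_of_le hT.le).2 hk
  have h := AbsolutelyContinuousOnInterval.integral_deriv_mul_eq_sub
    (hψ.contDiffOn.absolutelyContinuousOnInterval (a := 0) (b := T))
    (hki.absolutelyContinuousOnInterval_intervalIntegral left_mem_uIcc)
  rw [intervalIntegral.integral_same, mul_zero, sub_zero] at h
  rw [← h, intervalIntegral.integral_of_le hT.le, integral_Ioc_eq_integral_Ioo]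
  refine integral_congr_ae ?_
  rw [EventuallyEq, ae_restrict_iff' measurableSet_Ioo]
  filter_upwards [hki.ae_hasDerivAt_integral] with t ht htI
  have h0 : t ∈ uIcc 0 T := by rw [uIcc_of_le hT.le]; exact Ioo_subset_Icc_self htI
  rw [(ht h0 0 left_mem_uIcc).deriv]

/-- A function on an interval whose weak derivative vanishes is constant. -/
theorem exists_ae_eq_const_of_forall_integral_deriv_mul {T : ℝ} (hT : 0 < T) {g : ℝ → ℝ}
    (hg : IntegrableOn g (Ioo 0 T))
    (h : ∀ ψ : ℝ → ℝ, ContDiff ℝ 1 ψ → HasCompactSupport ψ → tsupport ψ ⊆ Ioo 0 T →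
      ∫ t in Ioo 0 T, deriv ψ t * g t = 0) :
    ∃ c : ℝ, ∀ᵐ t ∂(volume.restrict (Ioo 0 T)), g t = c := by
  -- Any unit-mass bump with compact support in `(0, T)` works; it serves to correct a test function
  -- to mean zero.
  let B : ContDiffBump (T / 2) := ⟨T / 8, T / 4, by positivity, by linarith⟩
  set φ₀ : ℝ → ℝ := B.normed volume with hφ₀
  have hφ₀d : ContDiff ℝ (⊤ : ℕ∞) φ₀ := B.contDiff_normed
  have hφ₀s : tsupport φ₀ ⊆ Ioo 0 T := by
    rw [hφ₀, B.tsupport_normed_eq, Real.closedBall_eq_Icc]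
    exact Icc_subset_Ioo (by change 0 < T / 2 - T / 4; linarith)
      (by change T / 2 + T / 4 < T; linarith)
  have hφ₀c : HasCompactSupport φ₀ := B.hasCompactSupport_normed
  have hφ₀i : ∫ t, φ₀ t = 1 := B.integral_normed
  refine ⟨∫ t in Ioo 0 T, φ₀ t * g t, ?_⟩
  set c := ∫ t in Ioo 0 T, φ₀ t * g t with hc
  have hmul : ∀ φ : ℝ → ℝ, Continuous φ → HasCompactSupport φ →
      IntegrableOn (fun t => φ t * g t) (Ioo 0 T) := by
    intro φ hφ hφc
    obtain ⟨C, hC⟩ := hφc.exists_bound_of_continuous hφ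
    exact hg.bdd_mul hφ.aestronglyMeasurable.restrict (ae_of_all _ hC)
  have key := isOpen_Ioo.ae_eq_zero_of_integral_contDiff_smul_eq_zero
    (f := fun t => g t - c) (U := Ioo 0 T) (μ := volume)
    ((hg.sub (integrableOn_const (by simp))).locallyIntegrableOn) ?_
  · rw [ae_restrict_iff' measurableSet_Ioo]
    filter_upwards [key] with t ht htI using sub_eq_zero.1 (ht htI)
  intro φ hφ hφc hφs
  -- Having mean zero, `ρ` is the derivative of a compactly supported function, namely its primitive
  -- from `0`, which is admissible in `h`.
  set ρ : ℝ → ℝ := fun t => φ t - (∫ s, φ s) * φ₀ t with hρ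
  have hρc : Continuous ρ := hφ.continuous.sub (continuous_const.mul hφ₀d.continuous)
  have hρ0 : ∀ t, t ∉ tsupport φ ∪ tsupport φ₀ → ρ t = 0 := by
    intro t ht
    rw [mem_union, not_or] at ht
    simp [hρ, image_eq_zero_of_notMem_tsupport ht.1, image_eq_zero_of_notMem_tsupport ht.2]
  have hK : IsCompact (tsupport φ ∪ tsupport φ₀) := hφc.isCompact.union hφ₀c.isCompact
  have hKn : (tsupport φ ∪ tsupport φ₀).Nonempty := by
    by_contra hne
    rw [not_nonempty_iff_eq_empty, union_empty_iff] at hne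
    have : φ₀ = 0 := tsupport_eq_empty_iff.1 hne.2
    simp [this] at hφ₀i
  have hKs : tsupport φ ∪ tsupport φ₀ ⊆ Ioo 0 T := union_subset hφs hφ₀s
  obtain ⟨a, haK, ha⟩ := hK.exists_isLeast hKn
  obtain ⟨b, hbK, hb⟩ := hK.exists_isGreatest hKn
  have hρi : ∫ t, ρ t = 0 := by
    rw [hρ, integral_sub (hφ.continuous.integrable_of_hasCompactSupport hφc)
      ((hφ₀d.continuous.integrable_of_hasCompactSupport hφ₀c).const_mul _), integral_const_mul,
      hφ₀i, mul_one, sub_self]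
  set ψ : ℝ → ℝ := fun t => ∫ s in (0 : ℝ)..t, ρ s with hψ
  have hψd : ∀ t, HasDerivAt ψ (ρ t) t := fun t =>
    intervalIntegral.integral_hasDerivAt_right (hρc.intervalIntegrable _ _)
      hρc.stronglyMeasurable.stronglyMeasurableAtFilter hρc.continuousAt
  have hψ' : deriv ψ = ρ := funext fun t => (hψd t).deriv
  have hψC : ContDiff ℝ 1 ψ := by
    rw [contDiff_one_iff_deriv, hψ']
    exact ⟨fun t => (hψd t).differentiableAt, hρc⟩
  have hψs : ∀ t, t ∉ Icc a b → ψ t = 0 := by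
    intro t ht
    have hout : ∀ s, s ∉ Icc a b → ρ s = 0 := fun s hs =>
      hρ0 s fun hsK => hs ⟨ha hsK, hb hsK⟩
    rcases lt_or_ge t a with hta | hta
    · have : EqOn ρ 0 (uIcc 0 t) := fun s hs => hout s fun hs' => by
        have h1 := (hKs haK).1
        rcases le_total 0 t with h0 | h0
        · rw [uIcc_of_le h0] at hs; exact absurd (hs.2.trans_lt hta) (not_lt.2 hs'.1)
        · rw [uIcc_of_ge h0] at hs; exact absurd (hs.2.trans_lt h1) (not_lt.2 hs'.1)
      rw [hψ]
      change ∫ s in (0 : ℝ)..t, ρ s = 0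
      rw [intervalIntegral.integral_congr this]; simp
    · have htb : b < t := not_le.1 fun h' => ht ⟨hta, h'⟩
      have ha0 := (hKs haK).1
      have hbt : a ≤ b := ha hbK
      change ∫ s in (0 : ℝ)..t, ρ s = 0
      rw [intervalIntegral.integral_of_le (by linarith), ← hρi]
      refine setIntegral_eq_integral_of_forall_compl_eq_zero fun s hs => hout s fun hs' => hs ?_
      exact ⟨by linarith [hs'.1], by linarith [hs'.2]⟩
  have hψts : tsupport ψ ⊆ Icc a b :=
    closure_minimal (fun t ht => by by_contra h'; exact ht (hψs t h')) isClosed_Icc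
  have hI : Icc a b ⊆ Ioo 0 T := Icc_subset_Ioo (hKs haK).1 (hKs hbK).2
  have := h ψ hψC (HasCompactSupport.of_support_subset_isCompact isCompact_Icc
    (subset_closure.trans hψts)) (hψts.trans hI)
  rw [hψ'] at this
  have e1 : ∫ t in Ioo 0 T, ρ t * g t = (∫ t in Ioo 0 T, φ t * g t) - (∫ s, φ s) * c := by
    rw [hc, ← integral_const_mul, ← integral_sub (hmul φ hφ.continuous hφc)
      ((hmul φ₀ hφ₀d.continuous hφ₀c).const_mul _)]
    refine integral_congr_ae (ae_of_all _ fun t => ?_)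
    simp only [hρ]; ring
  have e2 : ∫ t, φ t = ∫ t in Ioo 0 T, φ t :=
    (setIntegral_eq_integral_of_forall_compl_eq_zero fun s hs =>
      image_eq_zero_of_notMem_tsupport fun h' => hs (hφs h')).symm
  have e3 : ∫ t, φ t • (g t - c) = ∫ t in Ioo 0 T, φ t • (g t - c) :=
    (setIntegral_eq_integral_of_forall_compl_eq_zero fun s hs => by
      rw [image_eq_zero_of_notMem_tsupport fun h' => hs (hφs h'), zero_smul]).symm
  rw [e3]
  have e4 : ∫ t in Ioo 0 T, φ t • (g t - c)
      = (∫ t in Ioo 0 T, φ t * g t) - ∫ t in Ioo 0 T, φ t * c := by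
    rw [← integral_sub (hmul φ hφ.continuous hφc)
      ((hφ.continuous.integrable_of_hasCompactSupport hφc).integrableOn.mul_const _)]
    refine integral_congr_ae (ae_of_all _ fun t => ?_)
    simp only [smul_eq_mul]; ring
  rw [e4, integral_mul_const, ← e2, ← e1, this]

theorem continuousOn_primitive_Icc {T : ℝ} (hT : 0 < T) {k : ℝ → ℝ}
    (hk : IntegrableOn k (Ioo 0 T)) :
    ContinuousOn (fun t => ∫ r in (0 : ℝ)..t, k r) (Icc 0 T) := by
  have hki : IntervalIntegrable k volume 0 T :=
    (intervalIntegrable_iff_integrableOn_Ioo_of_le hT.le).2 hk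
  rw [← uIcc_of_le hT.le]
  exact (hki.absolutelyContinuousOnInterval_intervalIntegral left_mem_uIcc).continuousOn

theorem integrableOn_primitive {T : ℝ} (hT : 0 < T) {k : ℝ → ℝ}
    (hk : IntegrableOn k (Ioo 0 T)) :
    IntegrableOn (fun t => ∫ r in (0 : ℝ)..t, k r) (Ioo 0 T) :=
  ((continuousOn_primitive_Icc hT hk).integrableOn_Icc).mono_set Ioo_subset_Icc_self

theorem integral_deriv_Ioo {T : ℝ} (hT : 0 < T) {ψ : ℝ → ℝ} (hψ : ContDiff ℝ 1 ψ) :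
    ∫ t in Ioo 0 T, deriv ψ t = ψ T - ψ 0 := by
  rw [← integral_Ioc_eq_integral_Ioo, ← intervalIntegral.integral_of_le hT.le]
  exact intervalIntegral.integral_deriv_eq_sub
    (fun t _ => hψ.differentiable one_ne_zero t)
    ((hψ.continuous_deriv le_rfl).intervalIntegrable _ _)

/-- Integration by parts for a function which is a.e. equal to a constant plus a primitive. -/
theorem integral_deriv_mul_add_of_ae_eq {T : ℝ} (hT : 0 < T) {h k : ℝ → ℝ} {c : ℝ}
    (hk : IntegrableOn k (Ioo 0 T))
    (hc : ∀ᵐ t ∂(volume.restrict (Ioo 0 T)), h t = c + ∫ r in (0 : ℝ)..t, k r)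
    {ψ : ℝ → ℝ} (hψ : ContDiff ℝ 1 ψ) (hψT : ψ T = 0) :
    ∫ t in Ioo 0 T, (deriv ψ t * h t + ψ t * k t) = -(ψ 0 * c) := by
  have hψ' := hψ.continuous_deriv le_rfl
  have hbd : ∀ φ : ℝ → ℝ, Continuous φ → ∀ f : ℝ → ℝ, IntegrableOn f (Ioo 0 T) →
      IntegrableOn (fun t => φ t * f t) (Ioo 0 T) := by
    intro φ hφ f hf
    obtain ⟨C, hC⟩ := isCompact_Icc.exists_bound_of_continuousOn (s := Icc 0 T) hφ.continuousOn
    refine hf.bdd_mul (c := C) hφ.aestronglyMeasurable.restrict ?_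
    rw [ae_restrict_iff' measurableSet_Ioo]
    exact ae_of_all _ fun t ht => hC t (Ioo_subset_Icc_self ht)
  have e : ∫ t in Ioo 0 T, (deriv ψ t * h t + ψ t * k t)
      = ∫ t in Ioo 0 T, (deriv ψ t * c +
        (deriv ψ t * (∫ r in (0 : ℝ)..t, k r) + ψ t * k t)) := by
    refine integral_congr_ae ?_
    filter_upwards [hc] with t ht
    rw [ht]; ring
  have hi : IntegrableOn (fun t => deriv ψ t * (∫ r in (0 : ℝ)..t, k r) + ψ t * k t) (Ioo 0 T) :=
    (hbd _ hψ' _ (integrableOn_primitive hT hk)).add (hbd _ hψ.continuous _ hk)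
  rw [e, integral_add (hbd _ hψ' _ (integrableOn_const (by simp))) hi,
    setIntegral_deriv_mul_primitive hT hk hψ, integral_mul_const, integral_deriv_Ioo hT hψ, hψT]
  ring

/-- The initial value of the continuous representative of a function in `W^{1,1}(0, T)`. -/
theorem HasW11Deriv.ae_eq {T : ℝ} (hT : 0 < T) {h k : ℝ → ℝ} (H : HasW11Deriv T h k) :
    ∀ᵐ t ∂(volume.restrict (Ioo 0 T)), h t =
      (T⁻¹ * ∫ s in Ioo 0 T, (h s + (s - T) * k s)) + ∫ r in (0 : ℝ)..t, k r := by
  obtain ⟨hh, hk, hw⟩ := H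
  obtain ⟨c, hc⟩ := exists_ae_eq_const_of_forall_integral_deriv_mul hT
    (g := fun t => h t - ∫ r in (0 : ℝ)..t, k r) (hh.sub (integrableOn_primitive hT hk)) (by
      intro ψ hψ hψc hψs
      have hψ' := hψ.continuous_deriv le_rfl
      have hbd : ∀ φ : ℝ → ℝ, Continuous φ → HasCompactSupport φ → ∀ f : ℝ → ℝ,
          IntegrableOn f (Ioo 0 T) → IntegrableOn (fun t => φ t * f t) (Ioo 0 T) := by
        intro φ hφ hφc f hf
        obtain ⟨C, hC⟩ := hφc.exists_bound_of_continuous hφ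
        exact hf.bdd_mul hφ.aestronglyMeasurable.restrict (ae_of_all _ hC)
      have h1 := setIntegral_deriv_mul_primitive hT hk hψ
      rw [image_eq_zero_of_notMem_tsupport fun h' => lt_irrefl T (hψs h').2, zero_mul,
        integral_add (hbd _ hψ' hψc.deriv _ (integrableOn_primitive hT hk))
          (hbd _ hψ.continuous hψc _ hk)] at h1
      simp only [mul_sub]
      rw [integral_sub (hbd _ hψ' hψc.deriv _ hh)
        (hbd _ hψ' hψc.deriv _ (integrableOn_primitive hT hk)), hw ψ hψ hψc hψs]
      linarith)
  have hc' : ∀ᵐ t ∂(volume.restrict (Ioo 0 T)), h t = c + ∫ r in (0 : ℝ)..t, k r := by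
    filter_upwards [hc] with t ht
    linarith
  -- The choice `ψ = t - T` has `ψ' = 1`, `ψ(T) = 0` and `ψ(0) = -T`, so integration by parts
  -- expresses `T c` as a time integral of `h` and `k`.
  have h2 := integral_deriv_mul_add_of_ae_eq hT hk hc' (ψ := fun t => t - T)
    (contDiff_id.sub contDiff_const) (sub_self T)
  have hd : ∀ t : ℝ, deriv (fun t : ℝ => t - T) t = 1 := fun t => by simp
  simp only [hd, one_mul, zero_sub] at h2
  rw [h2]
  filter_upwards [hc'] with t ht
  rw [ht]
  field_simp

/-! ### Continuous extension of families of operators -/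

/-- A continuous curve on `[0, T]` which belongs to a closed set for a.e. time belongs to it for
every time. -/
theorem mem_of_ae_mem {Y : Type*} [TopologicalSpace Y] {T : ℝ} (hT : 0 < T)
    (F : C(Icc (0 : ℝ) T, Y)) {S : Set Y} (hS : IsClosed S)
    (h : ∀ᵐ t ∂(volume.restrict (Ioo 0 T)), F (projIcc 0 T hT.le t) ∈ S) (t : Icc (0 : ℝ) T) :
    F t ∈ S := by
  set G : ℝ → Y := fun t => F (projIcc 0 T hT.le t)
  have hG : Continuous G := F.continuous.comp continuous_projIcc
  have hcl : IsClosed (G ⁻¹' S) := hS.preimage hG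
  have hnull : volume ((G ⁻¹' S)ᶜ ∩ Ioo 0 T) = 0 := by
    rw [ae_iff, Measure.restrict_apply' measurableSet_Ioo] at h
    exact h
  have hemp := ((hcl.isOpen_compl.inter isOpen_Ioo).measure_eq_zero_iff volume).1 hnull
  have hsub : Ioo 0 T ⊆ G ⁻¹' S := fun s hs => by
    by_contra h'
    exact (eq_empty_iff_forall_notMem.1 hemp s) ⟨h', hs⟩
  have := closure_minimal hsub hcl
  rw [closure_Ioo hT.ne] at this
  have ht := this t.2
  simpa [G, projIcc_val] using ht

theorem eq_of_ae_eq {Y : Type*} [TopologicalSpace Y] [T2Space Y] {T : ℝ} (hT : 0 < T)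
    {F G : C(Icc (0 : ℝ) T, Y)}
    (h : ∀ᵐ t ∂(volume.restrict (Ioo 0 T)),
      F (projIcc 0 T hT.le t) = G (projIcc 0 T hT.le t)) : F = G := by
  ext t
  exact mem_of_ae_mem hT (F.prodMk G) isClosed_diagonal h t

/-- A uniformly bounded family of operators which, on a dense subspace, agrees for a.e. time with
continuous curves, agrees for a.e. time with a strongly continuous family of operators. -/
theorem exists_stronglyContinuous_family {H K : Type*} [NormedAddCommGroup H] [NormedSpace ℝ H]
    [SecondCountableTopology H] [NormedAddCommGroup K] [NormedSpace ℝ K] [CompleteSpace K]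
    {T : ℝ} (hT : 0 < T) (A : Submodule ℝ H) (hA : Dense (A : Set H)) (P : ℝ → H →L[ℝ] K)
    (M : ℝ) (hP : ∀ t g, ‖P t g‖ ≤ M * ‖g‖)
    (hF : ∀ f ∈ A, ∃ F : C(Icc (0 : ℝ) T, K), ∀ᵐ t ∂(volume.restrict (Ioo 0 T)),
      F (projIcc 0 T hT.le t) = P t f) :
    ∃ L : H →L[ℝ] C(Icc (0 : ℝ) T, K), ∀ᵐ t ∂(volume.restrict (Ioo 0 T)), ∀ g,
      L g (projIcc 0 T hT.le t) = P t g := by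
  -- No sign is assumed on `M`; a negative `M` is possible only if every norm in `H` is zero.
  have hM : 0 ≤ M ∨ ∀ g : H, ‖g‖ = 0 := by
    by_cases h : ∃ g : H, ‖g‖ ≠ 0
    · obtain ⟨g, hg⟩ := h
      left
      have := (norm_nonneg _).trans (hP 0 g)
      exact nonneg_of_mul_nonneg_left this (lt_of_le_of_ne (norm_nonneg _) (Ne.symm hg))
    · right; push Not at h; exact h
  choose F hFP using hF
  let F' : A →ₗ[ℝ] C(Icc (0 : ℝ) T, K) :=
    { toFun := fun f => F f f.2
      map_add' := fun f g => eq_of_ae_eq hT (by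
        filter_upwards [hFP _ f.2, hFP _ g.2, hFP _ (f + g).2] with t h1 h2 h3
        rw [h3, ContinuousMap.add_apply, h1, h2, Submodule.coe_add, map_add])
      map_smul' := fun c f => eq_of_ae_eq hT (by
        filter_upwards [hFP _ f.2, hFP _ (c • f).2] with t h1 h3
        rw [h3, RingHom.id_apply, ContinuousMap.smul_apply, h1, Submodule.coe_smul, map_smul]) }
  have hbound : ∃ C, ∀ f : A, ‖F' f‖ ≤ C * ‖A.subtype f‖ := by
    refine ⟨M, fun f => ?_⟩
    have h0 : 0 ≤ M * ‖A.subtype f‖ := by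
      rcases hM with h | h
      · positivity
      · rw [h, mul_zero]
    refine (ContinuousMap.norm_le _ h0).2 fun t => ?_
    have := mem_of_ae_mem hT (F' f) (S := Metric.closedBall 0 (M * ‖A.subtype f‖))
      Metric.isClosed_closedBall (by
        filter_upwards [hFP _ f.2] with s hs
        rw [mem_closedBall_zero_iff]
        change ‖F f f.2 _‖ ≤ _
        rw [hs]
        exact hP s f) t
    rwa [mem_closedBall_zero_iff] at this
  have hdense : DenseRange A.subtype := by
    rw [DenseRange, Submodule.coe_subtype, Subtype.range_coe]
    exact hA
  set L := F'.extendOfNorm A.subtype with hL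
  have hLA : ∀ f : A, L f = F' f := fun f => LinearMap.extendOfNorm_eq hdense hbound f
  refine ⟨L, ?_⟩
  -- The exceptional null set of times depends on `f`. A countable dense subset makes it uniform,
  -- and continuity in `g` then covers all of `H`.
  obtain ⟨S, hSc, hSd⟩ := TopologicalSpace.exists_countable_dense A
  have hall : ∀ᵐ t ∂(volume.restrict (Ioo 0 T)), ∀ f ∈ S,
      L (f : H) (projIcc 0 T hT.le t) = P t f := by
    rw [ae_ball_iff hSc]
    intro f _
    filter_upwards [hFP f f.2] with t ht
    rw [hLA]
    exact ht
  have hSd' : Dense ((fun f : A => (f : H)) '' S) :=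
    hdense.dense_image continuous_subtype_val hSd
  filter_upwards [hall] with t ht g
  have h1 : Continuous fun g => L g (projIcc 0 T hT.le t) :=
    (continuous_eval_const _).comp L.continuous
  refine congrFun (Continuous.ext_on hSd' h1 (P t).continuous ?_) g
  rintro _ ⟨f, hf, rfl⟩
  exact ht f hf


/-! ### Composition operators on `L²` -/

section CompOp

variable {X Ω : Type*} [MeasurableSpace X] [MeasurableSpace Ω] {m : Measure X} {η : Measure Ω}
  {e : Ω → X} {c : ℝ≥0}

theorem quasiMeasurePreserving_of_map_le (he : Measurable e) (h : η.map e ≤ (c : ℝ≥0∞) • m) :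
    Measure.QuasiMeasurePreserving e η m :=
  ⟨he, Measure.absolutelyContinuous_of_le_smul h⟩

theorem eLpNorm_comp_le (he : Measurable e) (h : η.map e ≤ (c : ℝ≥0∞) • m) {g : X → ℝ}
    (hg : AEStronglyMeasurable g m) :
    eLpNorm (g ∘ e) 2 η ≤ (c : ℝ≥0∞) ^ (1 / 2 : ℝ) * eLpNorm g 2 m := by
  rw [← eLpNorm_map_measure
    (hg.mono_ac (quasiMeasurePreserving_of_map_le he h).absolutelyContinuous) he.aemeasurable]
  refine (eLpNorm_mono_measure _ h).trans ?_
  rw [eLpNorm_smul_measure_of_ne_top (by simp)]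
  simp

theorem memLp_two_comp (he : Measurable e) (h : η.map e ≤ (c : ℝ≥0∞) • m) {g : X → ℝ}
    (hg : MemLp g 2 m) : MemLp (g ∘ e) 2 η :=
  ⟨hg.1.comp_quasiMeasurePreserving (quasiMeasurePreserving_of_map_le he h),
    (eLpNorm_comp_le he h hg.1).trans_lt
      (ENNReal.mul_lt_top (ENNReal.rpow_lt_top_of_nonneg (by norm_num) ENNReal.coe_ne_top) hg.2)⟩

/-- The composition operator `g ↦ g ∘ e` from `L²(m)` to `L²(η)`, when `e_# η ≤ c m`. -/
noncomputable def compOp (he : Measurable e) (h : η.map e ≤ (c : ℝ≥0∞) • m) :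
    Lp ℝ 2 m →L[ℝ] Lp ℝ 2 η :=
  LinearMap.mkContinuous
    { toFun := fun g => (memLp_two_comp he h (Lp.memLp g)).toLp _
      map_add' := fun f g => by
        ext1
        filter_upwards [MemLp.coeFn_toLp (memLp_two_comp he h (Lp.memLp (f + g))),
          MemLp.coeFn_toLp (memLp_two_comp he h (Lp.memLp f)),
          MemLp.coeFn_toLp (memLp_two_comp he h (Lp.memLp g)),
          Lp.coeFn_add ((memLp_two_comp he h (Lp.memLp f)).toLp _)
            ((memLp_two_comp he h (Lp.memLp g)).toLp _),
          (quasiMeasurePreserving_of_map_le he h).ae (Lp.coeFn_add f g)] with x h1 h2 h3 h4 h5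
        rw [h1, h4, Pi.add_apply, h2, h3, Function.comp_apply, h5]
        rfl
      map_smul' := fun r f => by
        ext1
        filter_upwards [MemLp.coeFn_toLp (memLp_two_comp he h (Lp.memLp (r • f))),
          MemLp.coeFn_toLp (memLp_two_comp he h (Lp.memLp f)),
          Lp.coeFn_smul r ((memLp_two_comp he h (Lp.memLp f)).toLp _),
          (quasiMeasurePreserving_of_map_le he h).ae (Lp.coeFn_smul r f)] with x h1 h2 h4 h5
        rw [h1, RingHom.id_apply, h4, Pi.smul_apply, h2, Function.comp_apply, h5]
        rfl }
    ((c : ℝ) ^ (1 / 2 : ℝ)) (fun g => by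
      change ‖(memLp_two_comp he h (Lp.memLp g)).toLp _‖ ≤ _
      rw [Lp.norm_toLp, Lp.norm_def]
      have := ENNReal.toReal_mono (ENNReal.mul_ne_top
        (ENNReal.rpow_ne_top_of_nonneg (by norm_num) ENNReal.coe_ne_top) (Lp.memLp g).2.ne)
        (eLpNorm_comp_le he h (Lp.memLp g).1)
      rw [ENNReal.toReal_mul, ← ENNReal.toReal_rpow, ENNReal.coe_toReal] at this
      exact this)

theorem coeFn_compOp (he : Measurable e) (h : η.map e ≤ (c : ℝ≥0∞) • m) (g : Lp ℝ 2 m) :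
    compOp he h g =ᵐ[η] fun γ => g (e γ) :=
  MemLp.coeFn_toLp (memLp_two_comp he h (Lp.memLp g))

theorem norm_compOp_le (he : Measurable e) (h : η.map e ≤ (c : ℝ≥0∞) • m) (g : Lp ℝ 2 m) :
    ‖compOp he h g‖ ≤ (c : ℝ) ^ (1 / 2 : ℝ) * ‖g‖ :=
  ContinuousLinearMap.le_of_opNorm_le _ (LinearMap.mkContinuous_norm_le _ (by positivity) _) g

end CompOp

/-! ### Convergence in `L²` -/

/-- A curve of uniformly bounded functions which is pointwise continuous is continuous in `L²`. -/
theorem continuous_toLp_of_bounded {Ω S : Type*} [MeasurableSpace Ω] {η : Measure Ω}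
    [IsFiniteMeasure η] [TopologicalSpace S] [FirstCountableTopology S] {G : S → Ω → ℝ}
    (hG : ∀ s, MemLp (G s) 2 η) (hGm : ∀ s, Measurable (G s)) {M : ℝ} (hM : ∀ s, ∀ᵐ γ ∂η, |G s γ| ≤ M)
    (hcont : ∀ᵐ γ ∂η, Continuous fun s => G s γ) :
    Continuous fun s => (hG s).toLp (G s) := by
  rw [continuous_iff_continuousAt]
  intro s
  rw [ContinuousAt, Lp.tendsto_Lp_iff_tendsto_eLpNorm'']
  have hlim : Tendsto (fun r => ∫⁻ γ, ‖(G r - G s) γ‖ₑ ^ (2 : ℝ) ∂η) (𝓝 s)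
      (𝓝 (∫⁻ _, 0 ∂η)) := by
    refine tendsto_lintegral_filter_of_dominated_convergence
      (fun _ => ENNReal.ofReal (2 * M) ^ (2 : ℝ)) ?_ ?_ ?_ ?_
    · exact Eventually.of_forall fun r =>
        (((hGm r).sub (hGm s)).enorm).pow_const _
    · refine Eventually.of_forall fun r => ?_
      filter_upwards [hM r, hM s] with γ h1 h2
      gcongr
      rw [Real.enorm_eq_ofReal_abs, Pi.sub_apply]
      exact ENNReal.ofReal_le_ofReal ((abs_sub _ _).trans (by linarith))
    · rw [lintegral_const]
      exact ENNReal.mul_ne_top (ENNReal.rpow_ne_top_of_nonneg (by norm_num) ENNReal.ofReal_ne_top)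
        (measure_ne_top _ _)
    · filter_upwards [hcont] with γ hγ
      have h1 : Tendsto (fun r => G r γ - G s γ) (𝓝 s) (𝓝 0) := by
        rw [← sub_self (G s γ)]
        exact (hγ.tendsto s).sub_const _
      have h2 := (ENNReal.continuous_rpow_const (y := (2 : ℝ))).tendsto _ |>.comp
        ((continuous_enorm.tendsto _).comp h1)
      simpa [Function.comp_def] using h2
  simp only [eLpNorm_eq_lintegral_rpow_enorm_toReal two_ne_zero ENNReal.ofNat_ne_top, ENNReal.toReal_ofNat]
  have h3 := (ENNReal.continuous_rpow_const (y := (1 / 2 : ℝ))).tendsto _ |>.comp hlim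
  simpa [Function.comp_def] using h3

/-- A convergent sequence in `L²` has an a.e. convergent subsequence. -/
theorem exists_subseq_tendsto_ae {Ω : Type*} [MeasurableSpace Ω] {η : Measure Ω}
    {f : ℕ → Lp ℝ 2 η} {g : Lp ℝ 2 η} (h : Tendsto f atTop (𝓝 g)) :
    ∃ ns : ℕ → ℕ, StrictMono ns ∧ ∀ᵐ γ ∂η, Tendsto (fun i => f (ns i) γ) atTop (𝓝 (g γ)) :=
  (tendstoInMeasure_of_tendsto_Lp h).exists_seq_tendsto_ae

/-! ### Evaluation along curves -/

section Eval

variable {X : Type*} [TopologicalSpace X] [PolishSpace X] [MeasurableSpace X] [BorelSpace X]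
  {T : ℝ} (hT : 0 < T) [MeasurableSpace C(Icc (0 : ℝ) T, X)] [BorelSpace C(Icc (0 : ℝ) T, X)]

/-- Provides second countability, so that continuous maps on `ℝ × C([0, T]; X)` are measurable for
the product σ-algebra, and the standard Borel structure needed for conditional distributions. -/
instance polishSpace_curves : PolishSpace C(Icc (0 : ℝ) T, X) := by
  let _ := TopologicalSpace.upgradeIsCompletelyMetrizable X
  infer_instance

theorem measurable_iccExtend_prod :
    Measurable fun p : ℝ × C(Icc (0 : ℝ) T, X) => IccExtend hT.le p.2 p.1 := by
  have : Continuous fun p : ℝ × C(Icc (0 : ℝ) T, X) => p.2 (projIcc 0 T hT.le p.1) := by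
    have h1 : Continuous fun p : ℝ × C(Icc (0 : ℝ) T, X) => projIcc 0 T hT.le p.1 :=
      continuous_projIcc.comp continuous_fst
    fun_prop
  exact this.measurable

theorem measurable_iccExtend (t : ℝ) :
    Measurable fun γ : C(Icc (0 : ℝ) T, X) => IccExtend hT.le γ t :=
  (measurable_iccExtend_prod hT).comp measurable_prodMk_left

end Eval

theorem map_iccExtend_le {X : Type*} [TopologicalSpace X] [MeasurableSpace X] {T : ℝ} (hT : 0 < T)
    [MeasurableSpace C(Icc (0 : ℝ) T, X)] {m : Measure X} {η : Measure C(Icc (0 : ℝ) T, X)} {c : ℝ≥0}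
    (h : ∀ t : Icc (0 : ℝ) T, η.map (evalAt t) ≤ (c : ℝ≥0∞) • m) (t : ℝ) :
    η.map (fun γ : C(Icc (0 : ℝ) T, X) => IccExtend hT.le γ t) ≤ (c : ℝ≥0∞) • m :=
  h (projIcc 0 T hT.le t)


/-- Integrating over a fixed interval with an indicator turns the primitive into a parameter
integral, for which joint measurability in `(t, γ)` is available. -/
theorem setIntegral_indicator_Iic {T : ℝ} {t : ℝ} (ht : t ∈ Icc 0 T) (k : ℝ → ℝ) :
    ∫ r in Ioo 0 T, (Iic t).indicator k r = ∫ r in (0 : ℝ)..t, k r := by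
  rw [← integral_Ioc_eq_integral_Ioo, intervalIntegral.integral_of_le ht.1,
    setIntegral_indicator measurableSet_Iic]
  congr 2
  ext r
  simp only [mem_inter_iff, mem_Ioc, mem_Iic]
  exact ⟨fun h => ⟨h.1.1, h.2⟩, fun h => ⟨⟨h.1, h.2.trans ht.2⟩, h.2⟩⟩

/-! ### Boundedness and `L²` density of test functions -/

section TestAlgebra

variable {X : Type*} [MeasurableSpace X] {m : Measure X}
  {𝓔 : DirichletForm m} {C : CarreDuChamp 𝓔} {A : Submodule ℝ (Lp ℝ 2 m)} {T : ℝ}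
  {b : ℝ → Deriv C A} (R : BorelRep T b)

theorem exists_fn_bound (hA : IsTestAlgebra C A) (f : A) :
    ∃ M : ℝ, ∀ᵐ x ∂m, |R.fn f x| ≤ M := by
  have h := hA.memLp f f.2 ∞ le_top
  refine ⟨(eLpNormEssSup (f : Lp ℝ 2 m) m).toReal, ?_⟩
  have h2 : eLpNormEssSup (f : Lp ℝ 2 m) m ≠ ∞ := by
    have := h.2.ne
    rwa [eLpNorm_exponent_top] at this
  filter_upwards [R.fn_ae f, enorm_ae_le_eLpNormEssSup (f : Lp ℝ 2 m) m] with x hx hx2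
  rw [hx, ← Real.norm_eq_abs, ← toReal_enorm]
  exact ENNReal.toReal_mono h2 hx2

/-- The norm of the domain dominates the `L²` norm, and the domain is itself dense in `L²`. -/
theorem IsTestAlgebra.dense_coe (hA : IsTestAlgebra C A) : Dense (A : Set (Lp ℝ 2 m)) := by
  have h1 : 𝓔.dom ⊆ closure (A : Set (Lp ℝ 2 m)) := by
    intro f hf
    rw [Metric.mem_closure_iff]
    intro ε hε
    obtain ⟨g, hg, hgε⟩ := hA.dense f hf (ENNReal.ofReal (ε ^ 2))
      (ENNReal.ofReal_pos.2 (by positivity))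
    refine ⟨g, hg, ?_⟩
    have h2 : ENNReal.ofReal (‖g - f‖ ^ 2) < ENNReal.ofReal (ε ^ 2) :=
      lt_of_le_of_lt le_self_add hgε
    rw [ENNReal.ofReal_lt_ofReal_iff (by positivity)] at h2
    rw [dist_comm, dist_eq_norm]
    exact lt_of_pow_lt_pow_left₀ 2 hε.le h2
  have h2 := closure_minimal h1 isClosed_closure
  intro f
  exact h2 (𝓔.dense f)

end TestAlgebra

/-! ### Absolutely continuous representatives along curves, and the operator family they generate -/

section PathRep

variable {X : Type*} [TopologicalSpace X] [MeasurableSpace X] {m : Measure X}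
  {𝓔 : DirichletForm m} {C : CarreDuChamp 𝓔} {A : Submodule ℝ (Lp ℝ 2 m)} {T : ℝ} (hT : 0 < T)
  {b : ℝ → Deriv C A} (R : BorelRep T b)

/-- The value at time `0` of the absolutely continuous representative of `f ∘ γ`. -/
noncomputable def initialValue (f : A) (γ : C(Icc (0 : ℝ) T, X)) : ℝ :=
  T⁻¹ * ∫ s in Ioo 0 T,
    (R.fn f (IccExtend hT.le γ s) + (s - T) * R.dfn f (s, IccExtend hT.le γ s))

/-- The absolutely continuous representative of `f ∘ γ`, for `γ` solving the ODE. -/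
noncomputable def pathRep (f : A) (t : ℝ) (γ : C(Icc (0 : ℝ) T, X)) : ℝ :=
  initialValue hT R f γ +
    ∫ r in Ioo 0 T, (Iic t).indicator (fun r => R.dfn f (r, IccExtend hT.le γ r)) r

theorem pathRep_of_mem {t : ℝ} (ht : t ∈ Icc 0 T) (f : A) (γ : C(Icc (0 : ℝ) T, X)) :
    pathRep hT R f t γ = initialValue hT R f γ +
      ∫ r in (0 : ℝ)..t, R.dfn f (r, IccExtend hT.le γ r) := by
  rw [pathRep, setIntegral_indicator_Iic ht]

theorem pathRep_zero (f : A) : pathRep hT R f 0 = initialValue hT R f := by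
  funext γ
  rw [pathRep_of_mem hT R (left_mem_Icc.2 hT.le), intervalIntegral.integral_same, add_zero]

theorem SolvesODE.ae_eq {f : A} {γ : C(Icc (0 : ℝ) T, X)} (h : SolvesODE hT R f γ) :
    ∀ᵐ t ∂(volume.restrict (Ioo 0 T)), R.fn f (IccExtend hT.le γ t) =
      initialValue hT R f γ + ∫ r in (0 : ℝ)..t, R.dfn f (r, IccExtend hT.le γ r) :=
  HasW11Deriv.ae_eq hT h

theorem SolvesODE.ae_eq_pathRep {f : A} {γ : C(Icc (0 : ℝ) T, X)} (h : SolvesODE hT R f γ) :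
    ∀ᵐ t ∂(volume.restrict (Ioo 0 T)), R.fn f (IccExtend hT.le γ t) = pathRep hT R f t γ := by
  filter_upwards [h.ae_eq, self_mem_ae_restrict measurableSet_Ioo] with t ht htI
  rw [ht, pathRep_of_mem hT R (Ioo_subset_Icc_self htI)]

theorem SolvesODE.continuousOn_pathRep {f : A} {γ : C(Icc (0 : ℝ) T, X)}
    (h : SolvesODE hT R f γ) : ContinuousOn (fun t => pathRep hT R f t γ) (Icc 0 T) := by
  have := (continuousOn_primitive_Icc hT h.2.1).const_add (initialValue hT R f γ)
  exact this.congr fun t ht => pathRep_of_mem hT R ht f γ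

variable [PolishSpace X] [BorelSpace X]
  [MeasurableSpace C(Icc (0 : ℝ) T, X)] [BorelSpace C(Icc (0 : ℝ) T, X)]

theorem measurable_fn_iccExtend (f : A) :
    Measurable fun p : ℝ × C(Icc (0 : ℝ) T, X) => R.fn f (IccExtend hT.le p.2 p.1) :=
  (R.measurable_fn f).comp (measurable_iccExtend_prod hT)

theorem measurable_dfn_iccExtend (f : A) :
    Measurable fun p : ℝ × C(Icc (0 : ℝ) T, X) => R.dfn f (p.1, IccExtend hT.le p.2 p.1) :=
  (R.measurable_dfn f).comp (measurable_fst.prodMk (measurable_iccExtend_prod hT))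

/-- This is where defining the initial value by a time integral pays off: its measurability in `γ`
is that of a parameter integral and needs no integrability. -/
theorem measurable_initialValue (f : A) : Measurable (initialValue hT R f) := by
  have h : Measurable fun p : ℝ × C(Icc (0 : ℝ) T, X) =>
      R.fn f (IccExtend hT.le p.2 p.1) + (p.1 - T) * R.dfn f (p.1, IccExtend hT.le p.2 p.1) :=
    (measurable_fn_iccExtend hT R f).add
      ((measurable_fst.sub_const T).mul (measurable_dfn_iccExtend hT R f))
  have h2 := (h.comp measurable_swap).stronglyMeasurable
  exact (StronglyMeasurable.integral_prod_right' (ν := volume.restrict (Ioo 0 T))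
    h2).measurable.const_mul _

theorem measurable_pathRep_uncurry (f : A) :
    Measurable fun p : ℝ × C(Icc (0 : ℝ) T, X) => pathRep hT R f p.1 p.2 := by
  refine ((measurable_initialValue hT R f).comp measurable_snd).add ?_
  have h : Measurable fun q : (ℝ × C(Icc (0 : ℝ) T, X)) × ℝ =>
      {q : (ℝ × C(Icc (0 : ℝ) T, X)) × ℝ | q.2 ≤ q.1.1}.indicator
        (fun q => R.dfn f (q.2, IccExtend hT.le q.1.2 q.2)) q := by
    refine Measurable.indicator ?_ (measurableSet_le measurable_snd
      (measurable_fst.comp measurable_fst))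
    exact (measurable_dfn_iccExtend hT R f).comp
      (measurable_snd.prodMk (measurable_snd.comp measurable_fst))
  exact (StronglyMeasurable.integral_prod_right' (ν := volume.restrict (Ioo 0 T))
    h.stronglyMeasurable).measurable

variable {η : Measure C(Icc (0 : ℝ) T, X)}

/-- The composition operators `g ↦ g(γ_t)`. -/
noncomputable def evalOp {c : ℝ≥0}
    (hc : ∀ t : Icc (0 : ℝ) T, η.map (evalAt t) ≤ (c : ℝ≥0∞) • m) (t : ℝ) :
    Lp ℝ 2 m →L[ℝ] Lp ℝ 2 η :=
  compOp (measurable_iccExtend hT t) (map_iccExtend_le hT hc t)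

theorem coeFn_evalOp {c : ℝ≥0}
    (hc : ∀ t : Icc (0 : ℝ) T, η.map (evalAt t) ≤ (c : ℝ≥0∞) • m) (t : ℝ) (g : Lp ℝ 2 m) :
    evalOp hT hc t g =ᵐ[η] fun γ => g (IccExtend hT.le γ t) :=
  coeFn_compOp _ _ g

variable [IsProbabilityMeasure η]

/-- The ODE gives the equality for a.e. time along a.e. curve; Fubini exchanges the quantifiers,
giving an identity in `L²(η)` at a.e. fixed time. -/
theorem ae_ae_fn_eq_pathRep (hη : ConcentratedOnSolutions hT R η) (f : A) :
    ∀ᵐ t ∂(volume.restrict (Ioo 0 T)), ∀ᵐ γ : C(Icc (0 : ℝ) T, X) ∂η,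
      R.fn f (IccExtend hT.le γ t) = pathRep hT R f t γ := by
  rw [Measure.ae_ae_comm]
  · filter_upwards [hη f] with γ hγ using hγ.ae_eq_pathRep
  · exact measurableSet_eq_fun (measurable_fn_iccExtend hT R f) (measurable_pathRep_uncurry hT R f)

/-- The `m`-a.e. bound transfers to a.e. curve at a.e. time because the marginals are absolutely
continuous. Continuity of the representative extends it to every time. The resulting uniform bound
is the domination behind continuity in `L²(η)`. -/
theorem ae_forall_pathRep_le (hη : ConcentratedOnSolutions hT R η) {c : ℝ≥0}
    (hc : ∀ t : Icc (0 : ℝ) T, η.map (evalAt t) ≤ (c : ℝ≥0∞) • m) {f : A} {M : ℝ}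
    (hM : ∀ᵐ x ∂m, |R.fn f x| ≤ M) :
    ∀ᵐ γ ∂η, ∀ t ∈ Icc 0 T, |pathRep hT R f t γ| ≤ M := by
  have h1 : ∀ᵐ t ∂(volume.restrict (Ioo 0 T)), ∀ᵐ γ ∂η, |pathRep hT R f t γ| ≤ M := by
    filter_upwards [ae_ae_fn_eq_pathRep hT R hη f] with t ht
    filter_upwards [ht, (quasiMeasurePreserving_of_map_le (measurable_iccExtend hT t)
      (map_iccExtend_le hT hc t)).ae hM] with γ h2 h3
    rwa [← h2]
  rw [Measure.ae_ae_comm (p := fun t γ => |pathRep hT R f t γ| ≤ M) (measurableSet_le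
    (measurable_abs.comp (measurable_pathRep_uncurry hT R f)) measurable_const)] at h1
  filter_upwards [h1, hη f] with γ hγ hs t ht
  have := mem_of_ae_mem hT ⟨_, (hs.continuousOn_pathRep).domRestrict⟩ (S := {r : ℝ | |r| ≤ M})
    (isClosed_le continuous_abs continuous_const) (by
      filter_upwards [hγ, self_mem_ae_restrict measurableSet_Ioo] with s hs' hsI
      simpa [projIcc_of_mem hT.le (Ioo_subset_Icc_self hsI)] using hs') ⟨t, ht⟩
  exact this

/-- For a test function `f`, the curve `t ↦ f(γ_t)` has a continuous representative in
`L²(η)`. -/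
theorem exists_continuous_evalOp (hA : IsTestAlgebra C A) (hη : ConcentratedOnSolutions hT R η)
    {c : ℝ≥0} (hc : ∀ t : Icc (0 : ℝ) T, η.map (evalAt t) ≤ (c : ℝ≥0∞) • m) (f : A) :
    ∃ F : C(Icc (0 : ℝ) T, Lp ℝ 2 η),
      (∀ᵐ t ∂(volume.restrict (Ioo 0 T)), F (projIcc 0 T hT.le t) = evalOp hT hc t f) ∧
      F (time0 hT) =ᵐ[η] initialValue hT R f := by
  obtain ⟨M, hM⟩ := exists_fn_bound R hA f
  have hb := ae_forall_pathRep_le hT R hη hc hM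
  have hmeas : ∀ t, Measurable (pathRep hT R f t) := fun t =>
    (measurable_pathRep_uncurry hT R f).comp measurable_prodMk_left
  have hbt : ∀ t : Icc (0 : ℝ) T, ∀ᵐ γ ∂η, |pathRep hT R f t γ| ≤ M := fun t => by
    filter_upwards [hb] with γ hγ using hγ t t.2
  have hL : ∀ t : Icc (0 : ℝ) T, MemLp (pathRep hT R f t) 2 η := fun t =>
    MemLp.of_bound (hmeas t).aestronglyMeasurable M (hbt t)
  refine ⟨⟨_, continuous_toLp_of_bounded hL (fun t => hmeas t) hbt ?_⟩, ?_, ?_⟩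
  · filter_upwards [hη f] with γ hγ using hγ.continuousOn_pathRep.domRestrict
  · filter_upwards [ae_ae_fn_eq_pathRep hT R hη f, self_mem_ae_restrict measurableSet_Ioo]
      with t ht htI
    ext1
    have hp : projIcc 0 T hT.le t = ⟨t, Ioo_subset_Icc_self htI⟩ := projIcc_of_mem _ _
    rw [hp]
    filter_upwards [ht, coeFn_evalOp hT hc t f, MemLp.coeFn_toLp (hL ⟨t, Ioo_subset_Icc_self htI⟩),
      (quasiMeasurePreserving_of_map_le (measurable_iccExtend hT t)
        (map_iccExtend_le hT hc t)).ae (R.fn_ae f)] with γ h1 h2 h3 h4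
    rw [h2, ← h4, h1]
    exact h3
  · refine (MemLp.coeFn_toLp (hL (time0 hT))).trans ?_
    change pathRep hT R f 0 =ᵐ[η] _
    rw [pathRep_zero]

/-- The strongly continuous family of operators `L²(m) → L²(η)` which agrees with `g ↦ g(γ_t)` for
a.e. time. -/
theorem exists_flowOp [SigmaFinite m] (hA : IsTestAlgebra C A)
    (hη : ConcentratedOnSolutions hT R η)
    {c : ℝ≥0} (hc : ∀ t : Icc (0 : ℝ) T, η.map (evalAt t) ≤ (c : ℝ≥0∞) • m) :
    ∃ L : Lp ℝ 2 m →L[ℝ] C(Icc (0 : ℝ) T, Lp ℝ 2 η),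
      (∀ᵐ t ∂(volume.restrict (Ioo 0 T)), ∀ g, L g (projIcc 0 T hT.le t) = evalOp hT hc t g) ∧
      ∀ f : A, L f (time0 hT) =ᵐ[η] initialValue hT R f := by
  -- Lets instance search find that `L²(m)` is second countable.
  have : Fact ((2 : ℝ≥0∞) ≠ ∞) := ⟨by simp⟩
  choose F hF hF0 using exists_continuous_evalOp hT R hA hη hc
  obtain ⟨L, hL⟩ := exists_stronglyContinuous_family hT A hA.dense_coe (evalOp hT hc)
    ((c : ℝ) ^ (1 / 2 : ℝ)) (fun t g => norm_compOp_le _ _ g) (fun f hf => ⟨F ⟨f, hf⟩, hF ⟨f, hf⟩⟩)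
  refine ⟨L, hL, fun f => ?_⟩
  have : L f = F f := eq_of_ae_eq hT (by
    filter_upwards [hL, hF f] with t h1 h2
    rw [h1, h2])
  rw [this]
  exact hF0 f

end PathRep


/-! ### Densities -/

theorem integrableOn_of_memLp_two {X : Type*} [MeasurableSpace X] {m : Measure X} {v : X → ℝ} (hv : MemLp v 2 m) {s : Set X} (hs : m s < ∞) :
    IntegrableOn v s m := by
  have : Fact (m s < ∞) := ⟨hs⟩
  exact (hv.restrict s).integrable one_le_two

theorem eLpNorm_top_le_of_ae {X : Type*} [MeasurableSpace X] {m : Measure X} {v : X → ℝ} {c : ℝ≥0} (h0 : 0 ≤ᵐ[m] v) (h : ∀ᵐ x ∂m, v x ≤ c) :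
    eLpNorm v ∞ m ≤ c := by
  rw [eLpNorm_exponent_top]
  refine eLpNormEssSup_le_of_ae_nnnorm_bound ?_
  filter_upwards [h0, h] with x h1 h2
  rw [← NNReal.coe_le_coe, coe_nnnorm, Real.norm_of_nonneg h1]
  exact h2

section Density

variable {X : Type*} [MeasurableSpace X] {m : Measure X} [SigmaFinite m]

/-- A finite kernel absolutely continuous with respect to a fixed measure has a jointly measurable
density. -/
theorem exists_measurable_density {S : Type*} [MeasurableSpace S]
    [MeasurableSpace.CountablyGenerated X] (κ : Kernel S X) [IsFiniteKernel κ]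
    (h : ∀ s, κ s ≪ m) :
    ∃ D : S × X → ℝ≥0∞, Measurable D ∧ ∀ s, κ s = m.withDensity fun x => D (s, x) := by
  -- The jointly measurable kernel derivative is taken with respect to the equivalent finite measure
  -- `m.toFinite`; the first factor converts back to `m`.
  refine ⟨fun p => m.toFinite.rnDeriv m p.2 * κ.rnDeriv (Kernel.const S m.toFinite) p.1 p.2,
    ((Measure.measurable_rnDeriv _ _).comp measurable_snd).mul (Kernel.measurable_rnDeriv _ _),
    fun s => ?_⟩
  have h1 : κ s ≪ m.toFinite := (h s).trans (absolutelyContinuous_toFinite m)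
  have h2 : (κ.rnDeriv (Kernel.const S m.toFinite) s) =ᵐ[m.toFinite] (κ s).rnDeriv m.toFinite :=
    Kernel.rnDeriv_eq_rnDeriv_measure
  have h3 := withDensity_mul m (Measure.measurable_rnDeriv m.toFinite m)
    (Kernel.measurable_rnDeriv_right κ (Kernel.const S m.toFinite) s)
  rw [Measure.withDensity_rnDeriv_eq _ _ (toFinite_absolutelyContinuous m),
    withDensity_congr_ae h2, Measure.withDensity_rnDeriv_eq _ _ h1] at h3
  exact h3.symm

theorem ae_nonneg_of_setIntegral {v : X → ℝ} (hv : MemLp v 2 m)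
    (h : ∀ s, MeasurableSet s → m s < ∞ → 0 ≤ ∫ x in s, v x ∂m) : 0 ≤ᵐ[m] v :=
  ae_nonneg_of_forall_setIntegral_nonneg_of_sigmaFinite
    (fun _ _ hs => integrableOn_of_memLp_two hv hs) h

theorem ae_le_const_of_setIntegral {v : X → ℝ} (hv : MemLp v 2 m) {c : ℝ}
    (h : ∀ s, MeasurableSet s → m s < ∞ → ∫ x in s, v x ∂m ≤ c * m.real s) :
    ∀ᵐ x ∂m, v x ≤ c := by
  have h1 : 0 ≤ᵐ[m] fun x => c - v x := by
    refine ae_nonneg_of_forall_setIntegral_nonneg_of_sigmaFinite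
      (fun s _ hs => (integrableOn_const hs.ne).sub (integrableOn_of_memLp_two hv hs))
      (fun s hs hs' => ?_)
    rw [integral_sub (integrableOn_const (C := c) hs'.ne) (integrableOn_of_memLp_two hv hs'),
      setIntegral_const, smul_eq_mul, mul_comm]
    exact sub_nonneg.2 (h s hs hs')
  filter_upwards [h1] with x hx using sub_nonneg.1 hx

theorem eLpNorm_one_le_of_setIntegral {v : X → ℝ} (hv : MemLp v 2 m) (h0 : 0 ≤ᵐ[m] v)
    (h : ∀ s, MeasurableSet s → m s < ∞ → ∫ x in s, v x ∂m ≤ 1) : eLpNorm v 1 m ≤ 1 := by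
  rw [eLpNorm_one_eq_lintegral_enorm]
  refine lintegral_le_of_forall_fin_meas_le 1 fun s hs hs' => ?_
  have h1 := h s hs hs'.lt_top
  have h2 : ∫⁻ x in s, ‖v x‖ₑ ∂m = ENNReal.ofReal (∫ x in s, v x ∂m) := by
    rw [ofReal_integral_eq_lintegral_ofReal (integrableOn_of_memLp_two hv hs'.lt_top)
      (ae_restrict_of_ae h0)]
    refine lintegral_congr_ae (ae_restrict_of_ae ?_)
    filter_upwards [h0] with x hx
    rw [Real.enorm_eq_ofReal hx]
  rw [h2]
  exact ENNReal.ofReal_le_one.2 h1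

end Density

/-! ### Densities of weighted marginals -/

theorem lintegral_ofReal_weight_le_one {Ω : Type*} [MeasurableSpace Ω] {η : Measure Ω}
    [IsProbabilityMeasure η] {W : Lp ℝ 2 η} (hW : ∀ᵐ γ ∂η, 0 ≤ W γ ∧ W γ ≤ 1) :
    ∫⁻ γ, ENNReal.ofReal (W γ) ∂η ≤ 1 := by
  calc ∫⁻ γ, ENNReal.ofReal (W γ) ∂η ≤ ∫⁻ _, 1 ∂η := by
        refine lintegral_mono_ae ?_
        filter_upwards [hW] with γ hγ
        exact ENNReal.ofReal_le_one.2 hγ.2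
    _ = 1 := by simp

section Marginals

variable {X : Type*} [TopologicalSpace X] [MeasurableSpace X] [PolishSpace X]
  [BorelSpace X] {m : Measure X} {T : ℝ} (hT : 0 < T)
  [MeasurableSpace C(Icc (0 : ℝ) T, X)] [BorelSpace C(Icc (0 : ℝ) T, X)]
  {η : Measure C(Icc (0 : ℝ) T, X)} {c : ℝ≥0}

theorem integral_indicator_evalOp
    (hc : ∀ t : Icc (0 : ℝ) T, η.map (evalAt t) ≤ (c : ℝ≥0∞) • m) (W : Lp ℝ 2 η) (t : ℝ)
    {s : Set X} (hs : MeasurableSet s) (hs' : m s ≠ ∞) :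
    ⟪evalOp hT hc t (indicatorConstLp 2 hs hs' 1), W⟫_ℝ
      = ∫ γ, s.indicator 1 (IccExtend hT.le γ t) * W γ ∂η := by
  rw [L2.inner_def]
  refine integral_congr_ae ?_
  filter_upwards [coeFn_evalOp hT hc t (indicatorConstLp 2 hs hs' 1),
    (quasiMeasurePreserving_of_map_le (measurable_iccExtend hT t)
      (map_iccExtend_le hT hc t)).ae (indicatorConstLp_coeFn (p := 2) (hs := hs) (hμs := hs')
        (c := (1 : ℝ)))] with γ h1 h2
  rw [h1, h2]
  simp only [RCLike.inner_apply, conj_trivial, mul_comm]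
  rfl

variable [SigmaFinite m] [IsProbabilityMeasure η]

/-- The time marginals of `W η` have a jointly measurable density. -/
theorem exists_marginal_density
    (hc : ∀ t : Icc (0 : ℝ) T, η.map (evalAt t) ≤ (c : ℝ≥0∞) • m)
    {W : Lp ℝ 2 η} (hW : ∀ᵐ γ ∂η, 0 ≤ W γ ∧ W γ ≤ 1) :
    ∃ U : ℝ × X → ℝ, Measurable U ∧ (∀ t, Integrable (fun x => U (t, x)) m) ∧
      ∀ t (G : X → ℝ), Measurable G →
      ∫ x, G x * U (t, x) ∂m = ∫ γ, G (IccExtend hT.le γ t) * W γ ∂η := by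
  set μ : Measure C(Icc (0 : ℝ) T, X) := η.withDensity fun γ => ENNReal.ofReal (W γ) with hμ
  have hWm : Measurable fun γ => ENNReal.ofReal (W γ) :=
    (Lp.stronglyMeasurable W).measurable.ennreal_ofReal
  have hμf : IsFiniteMeasure μ :=
    isFiniteMeasure_withDensity ((lintegral_ofReal_weight_le_one hW).trans_lt
      ENNReal.one_lt_top).ne
  have hev := fun t => measurable_iccExtend (X := X) hT t
  -- Viewing the time marginals of `W η` as a kernel in `t` yields a density that is jointly
  -- measurable in `(t, x)`.
  let κ : Kernel ℝ X :=
    ⟨fun t => μ.map fun γ : C(Icc (0 : ℝ) T, X) => IccExtend hT.le γ t, by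
      refine Measure.measurable_of_measurable_coe _ fun s hs => ?_
      simp_rw [Measure.map_apply (hev _) hs]
      exact measurable_measure_prodMk_left (measurable_iccExtend_prod hT hs)⟩
  have hκf : IsFiniteKernel κ := ⟨⟨μ univ, measure_lt_top _ _, fun t => by
    change μ.map (fun γ : C(Icc (0 : ℝ) T, X) => IccExtend hT.le γ t) univ ≤ _
    rw [Measure.map_apply (hev t) MeasurableSet.univ, preimage_univ]⟩⟩
  have hac : ∀ t, κ t ≪ m := fun t =>
    ((withDensity_absolutelyContinuous _ _).map (hev t)).trans
      (quasiMeasurePreserving_of_map_le (hev t) (map_iccExtend_le hT hc t)).absolutelyContinuous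
  obtain ⟨D, hD, hκD⟩ := exists_measurable_density κ hac
  have hDt : ∀ t, Measurable fun x => D (t, x) := fun t => hD.comp measurable_prodMk_left
  have hDi : ∀ t, ∫⁻ x, D (t, x) ∂m ≠ ∞ := fun t => by
    have : κ t univ ≠ ∞ := measure_ne_top _ _
    rwa [hκD, withDensity_apply _ MeasurableSet.univ, setLIntegral_univ] at this
  refine ⟨fun p => (D p).toReal, hD.ennreal_toReal,
    fun t => integrable_toReal_of_lintegral_ne_top (hDt t).aemeasurable (hDi t),
    fun t G hG => ?_⟩
  have hfin : ∀ᵐ x ∂m, D (t, x) < ∞ := ae_lt_top (hDt t) (hDi t)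
  have h1 : ∫ x, G x ∂(κ t) = ∫ x, G x * (D (t, x)).toReal ∂m := by
    rw [hκD, integral_withDensity_eq_integral_toReal_smul (hDt t) hfin]
    simp_rw [smul_eq_mul, mul_comm]
  have h2 : ∫ x, G x ∂(κ t) = ∫ γ, G (IccExtend hT.le γ t) * W γ ∂η := by
    change ∫ x, G x ∂(μ.map fun γ : C(Icc (0 : ℝ) T, X) => IccExtend hT.le γ t) = _
    rw [integral_map (hev t).aemeasurable hG.aestronglyMeasurable, hμ,
      integral_withDensity_eq_integral_toReal_smul hWm (by simp)]
    refine integral_congr_ae ?_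
    filter_upwards [hW] with γ hγ
    rw [ENNReal.toReal_ofReal hγ.1, smul_eq_mul, mul_comm]
  rw [← h1, h2]

end Marginals

/-! ### Dual densities -/

section Dual

variable {X : Type*} [TopologicalSpace X] [MeasurableSpace X] {m : Measure X} {T : ℝ}
  [MeasurableSpace C(Icc (0 : ℝ) T, X)] {η : Measure C(Icc (0 : ℝ) T, X)}

/-- The density at time `t` of the weakly continuous curve of measures associated with a weight. -/
noncomputable def dualDensity (L : Lp ℝ 2 m →L[ℝ] C(Icc (0 : ℝ) T, Lp ℝ 2 η)) (W : Lp ℝ 2 η)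
    (t : Icc (0 : ℝ) T) : Lp ℝ 2 m :=
  ContinuousLinearMap.adjoint ((ContinuousMap.evalCLM ℝ t).comp L) W

theorem inner_dualDensity (L : Lp ℝ 2 m →L[ℝ] C(Icc (0 : ℝ) T, Lp ℝ 2 η)) (W : Lp ℝ 2 η)
    (t : Icc (0 : ℝ) T) (g : Lp ℝ 2 m) : ⟪g, dualDensity L W t⟫_ℝ = ⟪L g t, W⟫_ℝ :=
  ContinuousLinearMap.adjoint_inner_right _ _ _

variable [PolishSpace X] [BorelSpace X] (hT : 0 < T)
  [BorelSpace C(Icc (0 : ℝ) T, X)] {c : ℝ≥0}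
  {hc : ∀ t : Icc (0 : ℝ) T, η.map (evalAt t) ≤ (c : ℝ≥0∞) • m}
  {L : Lp ℝ 2 m →L[ℝ] C(Icc (0 : ℝ) T, Lp ℝ 2 η)}

/-- For a.e. time the dual density is the density of the time marginal of `W η`. -/
theorem dualDensity_ae_eq [SigmaFinite m]
    (hL : ∀ᵐ t ∂(volume.restrict (Ioo 0 T)), ∀ g, L g (projIcc 0 T hT.le t) = evalOp hT hc t g)
    {W : Lp ℝ 2 η} {U : ℝ × X → ℝ} (hU : ∀ t, Integrable (fun x => U (t, x)) m)
    (hUW : ∀ t (G : X → ℝ), Measurable G →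
      ∫ x, G x * U (t, x) ∂m = ∫ γ, G (IccExtend hT.le γ t) * W γ ∂η) :
    ∀ᵐ t ∂(volume.restrict (Ioo 0 T)),
      (fun x => U (t, x)) =ᵐ[m] dualDensity L W (projIcc 0 T hT.le t) := by
  filter_upwards [hL] with t ht
  refine ae_eq_of_forall_setIntegral_eq_of_sigmaFinite (fun s _ _ => (hU t).integrableOn)
    (fun s _ hs => integrableOn_of_memLp_two (Lp.memLp _) hs) fun s hs hs' => ?_
  rw [← L2.inner_indicatorConstLp_one hs hs'.ne, inner_dualDensity, ht,
    integral_indicator_evalOp hT hc W t hs hs'.ne, ← hUW t _ (measurable_one.indicator hs),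
    ← integral_indicator hs]
  refine integral_congr_ae (ae_of_all _ fun x => ?_)
  by_cases h : x ∈ s <;> simp [h]

variable [IsProbabilityMeasure η]

/-- For a.e. time this integral is the mass that the marginal of `W η` gives to `s`, and the bounds
are clear there. They define a closed set and the integral is continuous in `t`, so they hold at
every time. The sign and the `L¹` and `L^∞` bounds of the dual density all follow. -/
theorem setIntegral_dualDensity_mem
    (hL : ∀ᵐ t ∂(volume.restrict (Ioo 0 T)), ∀ g, L g (projIcc 0 T hT.le t) = evalOp hT hc t g)
    {W : Lp ℝ 2 η} (hW : ∀ᵐ γ ∂η, 0 ≤ W γ ∧ W γ ≤ 1) (t : Icc (0 : ℝ) T)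
    {s : Set X} (hs : MeasurableSet s) (hs' : m s ≠ ∞) :
    ∫ x in s, dualDensity L W t x ∂m ∈ Icc 0 (min (c * m.real s) 1) := by
  set g : Lp ℝ 2 m := indicatorConstLp 2 hs hs' 1
  have h1 : ∀ t, ∫ x in s, dualDensity L W t x ∂m = ⟪L g t, W⟫_ℝ := fun t => by
    rw [← inner_dualDensity, L2.inner_indicatorConstLp_one]
  rw [h1]
  let F : C(Icc (0 : ℝ) T, ℝ) := ⟨fun t => ⟪L g t, W⟫_ℝ, by fun_prop⟩
  refine mem_of_ae_mem hT F (S := Icc 0 (min (c * m.real s) 1)) isClosed_Icc ?_ t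
  filter_upwards [hL] with r hr
  change ⟪L g (projIcc 0 T hT.le r), W⟫_ℝ ∈ _
  rw [hr g, integral_indicator_evalOp hT hc W r hs hs']
  have hev := measurable_iccExtend (X := X) hT r
  have hle : ∀ᵐ γ : C(Icc (0 : ℝ) T, X) ∂η, s.indicator (1 : X → ℝ) (IccExtend hT.le γ r) * W γ ≤
      s.indicator 1 (IccExtend hT.le γ r) := by
    filter_upwards [hW] with γ hγ
    exact mul_le_of_le_one_right (indicator_nonneg (fun _ _ => zero_le_one) _) hγ.2
  have hint : Integrable (fun γ : C(Icc (0 : ℝ) T, X) =>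
      s.indicator (1 : X → ℝ) (IccExtend hT.le γ r)) η := by
    refine Integrable.of_bound (((measurable_one.indicator hs).comp hev).aestronglyMeasurable) 1
      (ae_of_all _ fun γ => ?_)
    rw [Real.norm_eq_abs]
    by_cases h : IccExtend hT.le γ r ∈ s <;> simp [h]
  have h2 : ∫ γ : C(Icc (0 : ℝ) T, X), s.indicator (1 : X → ℝ) (IccExtend hT.le γ r) ∂η =
      (η.map fun γ : C(Icc (0 : ℝ) T, X) => IccExtend hT.le γ r).real s := by
    rw [← integral_map (f := s.indicator (1 : X → ℝ)) hev.aemeasurable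
      (measurable_one.indicator hs).aestronglyMeasurable, integral_indicator_one hs]
  have h0 : 0 ≤ ∫ γ : C(Icc (0 : ℝ) T, X),
      s.indicator (1 : X → ℝ) (IccExtend hT.le γ r) * W γ ∂η := by
    refine integral_nonneg_of_ae ?_
    filter_upwards [hW] with γ hγ
    exact mul_nonneg (indicator_nonneg (fun _ _ => zero_le_one) _) hγ.1
  have h3 := integral_mono_of_nonneg (by
    filter_upwards [hW] with γ hγ
    exact mul_nonneg (indicator_nonneg (fun _ _ => zero_le_one) _) hγ.1) hint hle
  rw [h2] at h3
  have : IsProbabilityMeasure (η.map fun γ : C(Icc (0 : ℝ) T, X) => IccExtend hT.le γ r) :=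
    Measure.isProbabilityMeasure_map hev.aemeasurable
  refine ⟨h0, le_min (h3.trans ?_) (h3.trans measureReal_le_one)⟩
  have h4 := map_iccExtend_le hT hc r s
  have h5 := ENNReal.toReal_mono (by
    rw [Measure.smul_apply, smul_eq_mul]
    exact ENNReal.mul_ne_top ENNReal.coe_ne_top hs') h4
  rw [Measure.smul_apply, smul_eq_mul, ENNReal.toReal_mul, ENNReal.coe_toReal] at h5
  exact h5

variable [SigmaFinite m]

theorem dualDensity_nonneg
    (hL : ∀ᵐ t ∂(volume.restrict (Ioo 0 T)), ∀ g, L g (projIcc 0 T hT.le t) = evalOp hT hc t g)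
    {W : Lp ℝ 2 η} (hW : ∀ᵐ γ ∂η, 0 ≤ W γ ∧ W γ ≤ 1) (t : Icc (0 : ℝ) T) :
    0 ≤ᵐ[m] dualDensity L W t :=
  ae_nonneg_of_setIntegral (Lp.memLp _) fun _ hs hs' =>
    (setIntegral_dualDensity_mem hT hL hW t hs hs'.ne).1

theorem eLpNorm_one_dualDensity_le
    (hL : ∀ᵐ t ∂(volume.restrict (Ioo 0 T)), ∀ g, L g (projIcc 0 T hT.le t) = evalOp hT hc t g)
    {W : Lp ℝ 2 η} (hW : ∀ᵐ γ ∂η, 0 ≤ W γ ∧ W γ ≤ 1) (t : Icc (0 : ℝ) T) :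
    eLpNorm (dualDensity L W t) 1 m ≤ 1 :=
  eLpNorm_one_le_of_setIntegral (Lp.memLp _) (dualDensity_nonneg hT hL hW t) fun _ hs hs' =>
    (setIntegral_dualDensity_mem hT hL hW t hs hs'.ne).2.trans (min_le_right _ _)

theorem eLpNorm_top_dualDensity_le
    (hL : ∀ᵐ t ∂(volume.restrict (Ioo 0 T)), ∀ g, L g (projIcc 0 T hT.le t) = evalOp hT hc t g)
    {W : Lp ℝ 2 η} (hW : ∀ᵐ γ ∂η, 0 ≤ W γ ∧ W γ ≤ 1) (t : Icc (0 : ℝ) T) :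
    eLpNorm (dualDensity L W t) ∞ m ≤ c :=
  eLpNorm_top_le_of_ae (dualDensity_nonneg hT hL hW t) <|
    ae_le_const_of_setIntegral (Lp.memLp _) fun _ hs hs' =>
      (setIntegral_dualDensity_mem hT hL hW t hs hs'.ne).2.trans (min_le_left _ _)

end Dual


/-! ### Weak solutions of the continuity equation -/

section Solutions

variable {X : Type*} [TopologicalSpace X] [PolishSpace X] [MeasurableSpace X] [BorelSpace X]
  {m : Measure X} {𝓔 : DirichletForm m} {C : CarreDuChamp 𝓔} {A : Submodule ℝ (Lp ℝ 2 m)}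
  {T : ℝ} (hT : 0 < T) {b : ℝ → Deriv C A} (R : BorelRep T b)
  [MeasurableSpace C(Icc (0 : ℝ) T, X)] [BorelSpace C(Icc (0 : ℝ) T, X)]
  {η : Measure C(Icc (0 : ℝ) T, X)} {c : ℝ≥0}

theorem lintegral_comp_iccExtend_le (hc : ∀ t : Icc (0 : ℝ) T, η.map (evalAt t) ≤ (c : ℝ≥0∞) • m)
    (t : ℝ) {G : X → ℝ≥0∞} (hG : Measurable G) :
    ∫⁻ γ, G (IccExtend hT.le γ t) ∂η ≤ c * ∫⁻ x, G x ∂m := by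
  rw [← lintegral_map hG (measurable_iccExtend hT t), ← smul_eq_mul, ← lintegral_smul_measure]
  exact lintegral_mono' (map_iccExtend_le hT hc t) le_rfl

variable [IsProbabilityMeasure η]

theorem integrable_fn_iccExtend (hA : IsTestAlgebra C A)
    (hc : ∀ t : Icc (0 : ℝ) T, η.map (evalAt t) ≤ (c : ℝ≥0∞) • m) (f : A) :
    Integrable (fun p : ℝ × C(Icc (0 : ℝ) T, X) => R.fn f (IccExtend hT.le p.2 p.1))
      ((volume.restrict (Ioo 0 T)).prod η) := by
  obtain ⟨M, hM⟩ := exists_fn_bound R hA f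
  have hmeas := measurable_fn_iccExtend (X := X) hT R f
  refine Integrable.of_bound hmeas.aestronglyMeasurable M ?_
  rw [Measure.ae_prod_iff_ae_ae (measurableSet_le hmeas.norm measurable_const)]
  exact ae_of_all _ fun t => (quasiMeasurePreserving_of_map_le (measurable_iccExtend (X := X) hT t)
      (map_iccExtend_le hT hc t)).ae hM

variable [SigmaFinite m]

/-- With `Γ(f)` bounded, `|df(b_t)|` is at most a constant times `|g₁| + |g₂|`. The marginal bound
controls the first term along curves by its `L¹(m)` norm; the second is controlled by its essential
supremum, since `η` has mass one. -/
theorem integrable_dfn_iccExtend (hA : IsTestAlgebra C A) (hb : FamilyInL1L1Linf T b)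
    (hc : ∀ t : Icc (0 : ℝ) T, η.map (evalAt t) ≤ (c : ℝ≥0∞) • m) (f : A) :
    Integrable (fun p : ℝ × C(Icc (0 : ℝ) T, X) => R.dfn f (p.1, IccExtend hT.le p.2 p.1))
      ((volume.restrict (Ioo 0 T)).prod η) := by
  obtain ⟨g, ⟨⟨-, -, hg⟩, -⟩, g₁, g₂, hg₁, hg₂, hgs, hi₁, hi₂⟩ := hb
  have hmeas := measurable_dfn_iccExtend (X := X) hT R f
  set K : ℝ≥0∞ := ENNReal.ofReal (√(eLpNormEssSup (C.Γ (f : Lp ℝ 2 m)) m).toReal) with hK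
  have hΓ : ∀ᵐ x ∂m, ENNReal.ofReal (√(C.Γ (f : Lp ℝ 2 m) x)) ≤ K := by
    have h2 : eLpNormEssSup (C.Γ (f : Lp ℝ 2 m)) m ≠ ∞ := by
      have := (hA.gamma_bdd f f.2).2.ne
      rwa [eLpNorm_exponent_top] at this
    filter_upwards [enorm_ae_le_eLpNormEssSup (C.Γ (f : Lp ℝ 2 m)) m] with x hx
    refine ENNReal.ofReal_le_ofReal (Real.sqrt_le_sqrt ((le_abs_self _).trans ?_))
    rw [← Real.norm_eq_abs, ← toReal_enorm]
    exact ENNReal.toReal_mono h2 hx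
  have hbound : ∀ᵐ t ∂(volume.restrict (Ioo 0 T)),
      ∫⁻ γ : C(Icc (0 : ℝ) T, X), ‖R.dfn f (t, IccExtend hT.le γ t)‖ₑ ∂η ≤
        K * (c * eLpNorm (fun x => g₁ (t, x)) 1 m + eLpNorm (fun x => g₂ (t, x)) ∞ m) := by
    filter_upwards [hg, hgs, R.dfn_ae f] with t h1 h2 h3
    have h4 : ∀ᵐ x ∂m, ‖R.dfn f (t, x)‖ₑ ≤ K * (‖g₁ (t, x)‖ₑ +
        eLpNorm (fun x => g₂ (t, x)) ∞ m) := by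
      filter_upwards [h1 f, h2, h3, hΓ, enorm_ae_le_eLpNormEssSup (fun x => g₂ (t, x)) m]
        with x h1 h2 h3 h4 h5
      rw [h3, Real.enorm_eq_ofReal_abs]
      calc ENNReal.ofReal |(b t).d f x|
          ≤ ENNReal.ofReal (|g (t, x)| * √(C.Γ (f : Lp ℝ 2 m) x)) :=
            ENNReal.ofReal_le_ofReal (h1.trans (by gcongr; exact le_abs_self _))
        _ = ‖g (t, x)‖ₑ * ENNReal.ofReal (√(C.Γ (f : Lp ℝ 2 m) x)) := by
            rw [ENNReal.ofReal_mul (abs_nonneg _), Real.enorm_eq_ofReal_abs]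
        _ ≤ K * (‖g₁ (t, x)‖ₑ + eLpNorm (fun x => g₂ (t, x)) ∞ m) := by
            rw [mul_comm, h2, eLpNorm_exponent_top]
            exact mul_le_mul' h4 ((enorm_add_le _ _).trans (add_le_add le_rfl h5))
    have hqm := quasiMeasurePreserving_of_map_le (measurable_iccExtend (X := X) hT t)
      (map_iccExtend_le hT hc t)
    have hm₁ : Measurable fun x => ‖g₁ (t, x)‖ₑ := (hg₁.comp measurable_prodMk_left).enorm
    calc ∫⁻ γ : C(Icc (0 : ℝ) T, X), ‖R.dfn f (t, IccExtend hT.le γ t)‖ₑ ∂η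
        ≤ ∫⁻ γ : C(Icc (0 : ℝ) T, X), K * (‖g₁ (t, IccExtend hT.le γ t)‖ₑ +
            eLpNorm (fun x => g₂ (t, x)) ∞ m) ∂η := lintegral_mono_ae (hqm.ae h4)
      _ = K * ((∫⁻ γ : C(Icc (0 : ℝ) T, X), ‖g₁ (t, IccExtend hT.le γ t)‖ₑ ∂η) +
            eLpNorm (fun x => g₂ (t, x)) ∞ m) := by
          rw [lintegral_const_mul' _ _ ENNReal.ofReal_ne_top,
            lintegral_add_right _ measurable_const, lintegral_const, measure_univ, mul_one]
      _ ≤ _ := by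
          gcongr
          rw [eLpNorm_one_eq_lintegral_enorm]
          exact lintegral_comp_iccExtend_le hT hc t hm₁
  refine ⟨hmeas.aestronglyMeasurable, ?_⟩
  rw [HasFiniteIntegral, lintegral_prod _ hmeas.enorm.aemeasurable]
  refine (lintegral_mono_ae hbound).trans_lt ?_
  -- Splitting the integral of a sum needs measurability of one summand only, so none is required of
  -- the essential supremum of `g₂(t, ·)` in `t`.
  have hm : Measurable fun t => eLpNorm (fun x => g₁ (t, x)) 1 m := by
    simp_rw [eLpNorm_one_eq_lintegral_enorm]
    exact hg₁.enorm.lintegral_prod_right'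
  rw [lintegral_const_mul' _ _ ENNReal.ofReal_ne_top, lintegral_add_left (hm.const_mul _),
    lintegral_const_mul' _ _ ENNReal.coe_ne_top]
  exact ENNReal.mul_lt_top ENNReal.ofReal_lt_top
    (ENNReal.add_lt_top.2 ⟨ENNReal.mul_lt_top ENNReal.coe_lt_top hi₁, hi₂⟩)

/-- The superposition of solutions to the ODE, weighted by `W`, satisfies the continuity
equation. -/
theorem integral_weight_eq (hA : IsTestAlgebra C A) (hb : FamilyInL1L1Linf T b)
    (hη : ConcentratedOnSolutions hT R η)
    (hc : ∀ t : Icc (0 : ℝ) T, η.map (evalAt t) ≤ (c : ℝ≥0∞) • m)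
    {W : Lp ℝ 2 η} (hW : ∀ᵐ γ ∂η, 0 ≤ W γ ∧ W γ ≤ 1) (f : A) {ψ : ℝ → ℝ}
    (hψ : ContDiff ℝ 1 ψ) (hψT : ψ T = 0) :
    ∫ t in Ioo 0 T, ∫ γ : C(Icc (0 : ℝ) T, X), (-(deriv ψ t) * R.fn f (IccExtend hT.le γ t) -
      ψ t * R.dfn f (t, IccExtend hT.le γ t)) * W γ ∂η
      = ψ 0 * ∫ γ, initialValue hT R f γ * W γ ∂η := by
  have hψ' := hψ.continuous_deriv le_rfl
  have hbd : ∀ φ : ℝ → ℝ, Continuous φ → ∃ M, ∀ᵐ p ∂((volume.restrict (Ioo 0 T)).prod η),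
      ‖φ p.1‖ ≤ M := by
    intro φ hφ
    obtain ⟨M, hM⟩ := isCompact_Icc.exists_bound_of_continuousOn (s := Icc 0 T) hφ.continuousOn
    refine ⟨M, Measure.quasiMeasurePreserving_fst.ae (p := fun t => ‖φ t‖ ≤ M) ?_⟩
    filter_upwards [self_mem_ae_restrict measurableSet_Ioo] with t ht
      using hM t (Ioo_subset_Icc_self ht)
  have hWp : ∀ᵐ p ∂((volume.restrict (Ioo 0 T)).prod η), ‖W p.2‖ ≤ 1 := by
    refine Measure.quasiMeasurePreserving_snd.ae (p := fun γ => ‖W γ‖ ≤ 1) ?_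
    filter_upwards [hW] with γ hγ
    rw [Real.norm_of_nonneg hγ.1]
    exact hγ.2
  obtain ⟨M₁, hM₁⟩ := hbd _ hψ'
  obtain ⟨M₂, hM₂⟩ := hbd _ hψ.continuous
  have hI : Integrable (fun p : ℝ × C(Icc (0 : ℝ) T, X) =>
      (-(deriv ψ p.1) * R.fn f (IccExtend hT.le p.2 p.1) -
        ψ p.1 * R.dfn f (p.1, IccExtend hT.le p.2 p.1)) * W p.2)
      ((volume.restrict (Ioo 0 T)).prod η) := by
    refine Integrable.mul_bdd (c := 1) (Integrable.sub ?_ ?_)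
      ((Lp.stronglyMeasurable W).comp_measurable measurable_snd).aestronglyMeasurable hWp
    · refine (integrable_fn_iccExtend hT R hA hc f).bdd_mul (c := M₁)
        (hψ'.neg.comp continuous_fst).aestronglyMeasurable ?_
      filter_upwards [hM₁] with p hp
      rwa [norm_neg]
    · exact (integrable_dfn_iccExtend hT R hA hb hc f).bdd_mul (c := M₂)
        (hψ.continuous.comp continuous_fst).aestronglyMeasurable hM₂
  -- After Fubini the identity holds curve by curve: integrating by parts along `γ` leaves only the
  -- boundary term at `0`, since `ψ(T) = 0`.
  rw [integral_integral_swap hI, ← integral_const_mul]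
  refine integral_congr_ae ?_
  filter_upwards [hη f] with γ hγ
  rw [integral_mul_const]
  have h := integral_deriv_mul_add_of_ae_eq hT hγ.2.1 hγ.ae_eq hψ hψT
  have h2 : ∫ t in Ioo 0 T, (-(deriv ψ t) * R.fn f (IccExtend hT.le γ t) -
      ψ t * R.dfn f (t, IccExtend hT.le γ t)) = ψ 0 * initialValue hT R f γ := by
    rw [← neg_neg (ψ 0 * _), ← h, ← integral_neg]
    refine integral_congr_ae (ae_of_all _ fun t => ?_)
    simp only []
    ring
  rw [h2, mul_assoc]

/-- For every weight `W` there is a solution of the continuity equation in the class `𝓛₊` whose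
density at each time is the dual density of `W`. -/
theorem exists_solution (hA : IsTestAlgebra C A) (hb : FamilyInL1L1Linf T b)
    (hη : ConcentratedOnSolutions hT R η)
    {hc : ∀ t : Icc (0 : ℝ) T, η.map (evalAt t) ≤ (c : ℝ≥0∞) • m}
    {L : Lp ℝ 2 m →L[ℝ] C(Icc (0 : ℝ) T, Lp ℝ 2 η)}
    (hL : ∀ᵐ t ∂(volume.restrict (Ioo 0 T)), ∀ g, L g (projIcc 0 T hT.le t) = evalOp hT hc t g)
    (hL0 : ∀ f : A, L f (time0 hT) =ᵐ[η] initialValue hT R f)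
    {W : Lp ℝ 2 η} (hW : ∀ᵐ γ ∂η, 0 ≤ W γ ∧ W γ ≤ 1) :
    ∃ u : ℝ → X → ℝ, MemLPlus m A T u ∧
      SolvesContinuityEq T b u (dualDensity L W (time0 hT)) ∧
      ∀ t : Icc (0 : ℝ) T, u t =ᵐ[m] dualDensity L W t := by
  classical
  obtain ⟨U, hUm, hUi, hUW⟩ := exists_marginal_density hT hc hW
  have hUd := dualDensity_ae_eq hT hL hUi hUW
  let v : ℝ → X → ℝ := fun t => dualDensity L W (projIcc 0 T hT.le t)
  -- `U` is jointly measurable but is known to be the right density only for a.e. `t`, while `v` is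
  -- right at every `t` but not known to be jointly measurable. This combination has both
  -- properties.
  let u : ℝ → X → ℝ := fun t => if (fun x => U (t, x)) =ᵐ[m] v t then fun x => U (t, x) else v t
  have huv : ∀ t, u t =ᵐ[m] v t := fun t => by
    by_cases h : (fun x => U (t, x)) =ᵐ[m] v t
    · simp only [u, if_pos h]; exact h
    · simp only [u, if_neg h]; rfl
  have huU : ∀ᵐ t ∂(volume.restrict (Ioo 0 T)), u t = fun x => U (t, x) := by
    filter_upwards [hUd] with t ht
    simp only [u]
    exact if_pos ht
  have hproj : ∀ t : Icc (0 : ℝ) T, projIcc 0 T hT.le t = t := fun t => projIcc_val _ t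
  have h1 : ∀ t, eLpNorm (u t) 1 m ≤ 1 := fun t => by
    rw [eLpNorm_congr_ae (huv t)]; exact eLpNorm_one_dualDensity_le hT hL hW _
  have h2 : ∀ t, eLpNorm (u t) ∞ m ≤ c := fun t => by
    rw [eLpNorm_congr_ae (huv t)]; exact eLpNorm_top_dualDensity_le hT hL hW _
  have h3 : ∀ t, AEStronglyMeasurable (u t) m := fun t =>
    (Lp.memLp (dualDensity L W (projIcc 0 T hT.le t))).1.congr (huv t).symm
  refine ⟨u, ⟨?_, fun t _ => ⟨h3 t, (h1 t).trans_lt ENNReal.one_lt_top⟩,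
    fun t _ => ⟨h3 t, (h2 t).trans_lt ENNReal.coe_lt_top⟩, ⟨max 1 c, ae_of_all _ fun t =>
      ⟨(h1 t).trans (by simp), (h2 t).trans (by simp)⟩⟩, fun t _ => ?_, fun f hf => ?_⟩, ?_, ?_⟩
  · refine ⟨U, hUm.stronglyMeasurable, ?_⟩
    filter_upwards [Measure.quasiMeasurePreserving_fst.ae huU] with p hp
    exact congrFun hp p.2
  · exact (dualDensity_nonneg hT hL hW _).trans (huv t).symm.le
  · have h4 : Continuous fun t => ⟪L f (projIcc 0 T hT.le t), W⟫_ℝ := by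
      have h5 : Continuous fun t => L f (projIcc 0 T hT.le t) :=
        (L f).continuous.comp continuous_projIcc
      exact h5.inner continuous_const
    refine h4.continuousOn.congr fun t _ => ?_
    change ∫ x, f x * u t x ∂m = ⟪L f (projIcc 0 T hT.le t), W⟫_ℝ
    rw [← inner_dualDensity, L2.inner_def]
    refine integral_congr_ae ?_
    filter_upwards [huv t] with x hx
    rw [hx, RCLike.inner_apply, conj_trivial, mul_comm]
  · intro f ψ hψ hψT
    have e1 : ψ 0 * ∫ x, (f : Lp ℝ 2 m) x * dualDensity L W (time0 hT) x ∂m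
        = ψ 0 * ∫ γ, initialValue hT R f γ * W γ ∂η := by
      have : ∫ x, (f : Lp ℝ 2 m) x * dualDensity L W (time0 hT) x ∂m =
          ⟪(f : Lp ℝ 2 m), dualDensity L W (time0 hT)⟫_ℝ := by
        rw [L2.inner_def]
        refine integral_congr_ae (ae_of_all _ fun x => ?_)
        simp only [RCLike.inner_apply, conj_trivial, mul_comm]
      rw [this, inner_dualDensity, L2.inner_def]
      congr 1
      refine integral_congr_ae ?_
      filter_upwards [hL0 f] with γ hγ
      rw [hγ, RCLike.inner_apply, conj_trivial, mul_comm]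
    rw [e1, ← integral_weight_eq hT R hA hb hη hc hW f hψ hψT]
    refine integral_congr_ae ?_
    filter_upwards [huU, R.dfn_ae f] with t ht ht2
    rw [ht, ← hUW t (fun x => -(deriv ψ t) * R.fn f x - ψ t * R.dfn f (t, x))
      (((R.measurable_fn f).const_mul _).sub
        (((R.measurable_dfn f).comp measurable_prodMk_left).const_mul _))]
    refine integral_congr_ae ?_
    filter_upwards [ht2, R.fn_ae f] with x hx hx2
    rw [hx, hx2]
  · intro t
    have := huv t
    simp only [v, hproj] at this
    exact this

/-- Under uniqueness for the continuity equation, the dual densities of two weights coincide at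
every time as soon as they coincide initially. -/
theorem dualDensity_eq_of_initial_eq (hA : IsTestAlgebra C A) (hb : FamilyInL1L1Linf T b)
    (hunique : UniqueInLPlus T b) (hη : ConcentratedOnSolutions hT R η)
    {hc : ∀ t : Icc (0 : ℝ) T, η.map (evalAt t) ≤ (c : ℝ≥0∞) • m}
    {L : Lp ℝ 2 m →L[ℝ] C(Icc (0 : ℝ) T, Lp ℝ 2 η)}
    (hL : ∀ᵐ t ∂(volume.restrict (Ioo 0 T)), ∀ g, L g (projIcc 0 T hT.le t) = evalOp hT hc t g)
    (hL0 : ∀ f : A, L f (time0 hT) =ᵐ[η] initialValue hT R f)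
    {W₁ W₂ : Lp ℝ 2 η} (hW₁ : ∀ᵐ γ ∂η, 0 ≤ W₁ γ ∧ W₁ γ ≤ 1)
    (hW₂ : ∀ᵐ γ ∂η, 0 ≤ W₂ γ ∧ W₂ γ ≤ 1)
    (h0 : dualDensity L W₁ (time0 hT) = dualDensity L W₂ (time0 hT)) (t : Icc (0 : ℝ) T) :
    dualDensity L W₁ t = dualDensity L W₂ t := by
  obtain ⟨u, hu, hus, hud⟩ := exists_solution hT R hA hb hη hL hL0 hW₁
  obtain ⟨v, hv, hvs, hvd⟩ := exists_solution hT R hA hb hη hL hL0 hW₂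
  rw [← h0] at hvs
  ext1
  exact (hud t).symm.trans ((hunique _
    ⟨(Lp.memLp _).1, (eLpNorm_one_dualDensity_le hT hL hW₁ _).trans_lt ENNReal.one_lt_top⟩
    ⟨(Lp.memLp _).1, (eLpNorm_top_dualDensity_le hT hL hW₁ _).trans_lt ENNReal.coe_lt_top⟩
    u v hu hv hus hvs t t.2).trans (hvd t))

end Solutions


/-! ### Continuity at the initial time -/

/-- A property valid for a.e. time in `(0, T)` is valid on a dense set of times. -/
theorem mem_closure_of_ae {T : ℝ} (hT : 0 < T) {p : ℝ → Prop}
    (h : ∀ᵐ t ∂(volume.restrict (Ioo 0 T)), p t) {t : ℝ} (ht : t ∈ Icc 0 T) :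
    t ∈ closure {s | s ∈ Ioo 0 T ∧ p s} := by
  have := mem_of_ae_mem hT (Y := ℝ) ⟨fun s : Icc (0 : ℝ) T => (s : ℝ), continuous_subtype_val⟩
    (S := closure {s | s ∈ Ioo 0 T ∧ p s}) isClosed_closure (by
      filter_upwards [h, self_mem_ae_restrict measurableSet_Ioo] with s hs hsI
      refine subset_closure ?_
      change (projIcc 0 T hT.le s : ℝ) ∈ _
      rw [projIcc_of_mem hT.le (Ioo_subset_Icc_self hsI)]
      exact ⟨hsI, hs⟩) ⟨t, ht⟩
  exact this

/-! ### Weighted continuous functions in `L²` -/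

section Weighted

variable {X : Type*} [MeasurableSpace X] {m : Measure X}

theorem exists_pos_memLp_two (m : Measure X) [SigmaFinite m] :
    ∃ h : X → ℝ, Measurable h ∧ (∀ x, 0 < h x) ∧ (∀ x, h x ≤ 1) ∧ MemLp h 2 m := by
  -- Truncating `g` at `1` suffices, because `min(g, 1)² ≤ g` is integrable.
  obtain ⟨g, hg0, hgm, hgi⟩ := exists_pos_lintegral_lt_of_sigmaFinite m one_ne_zero
  have hm : Measurable fun x => min (g x : ℝ) 1 := hgm.coe_nnreal_real.min measurable_const
  have h0 : ∀ x, 0 < min (g x : ℝ) 1 := fun x => lt_min (hg0 x) one_pos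
  refine ⟨_, hm, h0, fun x => min_le_right _ _, hm.aestronglyMeasurable, ?_⟩
  rw [eLpNorm_lt_top_iff_lintegral_rpow_enorm_lt_top two_ne_zero ENNReal.ofNat_ne_top]
  refine lt_of_le_of_lt (lintegral_mono fun x => ?_) (hgi.trans ENNReal.one_lt_top)
  rw [Real.enorm_eq_ofReal (h0 x).le, ENNReal.toReal_ofNat, ENNReal.rpow_two,
    ← ENNReal.ofReal_pow (h0 x).le, ← ENNReal.ofReal_coe_nnreal]
  refine ENNReal.ofReal_le_ofReal ?_
  calc min (g x : ℝ) 1 ^ 2 = min (g x : ℝ) 1 * min (g x : ℝ) 1 := sq _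
    _ ≤ min (g x : ℝ) 1 * 1 := mul_le_mul_of_nonneg_left (min_le_right _ _) (h0 x).le
    _ ≤ g x := by rw [mul_one]; exact min_le_left _ _

/-- Multiplication by `h` is an isometry from `L²(h² m)` to `L²(m)`. For `h` in `L²(m)` the weighted
measure is finite, so density of bounded continuous functions carries over even where `m` is not
locally finite. -/
theorem eLpNorm_two_withDensity_sq {h : X → ℝ} (hm : Measurable h) (f : X → ℝ) :
    eLpNorm f 2 (m.withDensity fun x => ENNReal.ofReal (h x ^ 2)) =
      eLpNorm (fun x => f x * h x) 2 m := by
  have hd : Measurable fun x => ENNReal.ofReal (h x ^ 2) := (hm.pow_const 2).ennreal_ofReal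
  rw [eLpNorm_eq_lintegral_rpow_enorm_toReal two_ne_zero ENNReal.ofNat_ne_top,
    eLpNorm_eq_lintegral_rpow_enorm_toReal two_ne_zero ENNReal.ofNat_ne_top,
    lintegral_withDensity_eq_lintegral_mul_non_measurable _ hd (by simp)]
  congr 1
  refine lintegral_congr fun x => ?_
  rw [Pi.mul_apply, enorm_mul, ENNReal.mul_rpow_of_nonneg _ _ (by simp), mul_comm]
  congr 1
  rw [Real.enorm_eq_ofReal_abs, ENNReal.toReal_ofNat, ENNReal.rpow_two,
    ← ENNReal.ofReal_pow (abs_nonneg _), sq_abs]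

/-- The products `φ h`, with `φ` continuous and `h > 0` fixed in `L²`, are dense in `L²`. -/
theorem dense_continuous_mul [TopologicalSpace X] [PolishSpace X] [BorelSpace X] {h : X → ℝ}
    (hm : Measurable h) (h0 : ∀ x, 0 < h x) (h2 : MemLp h 2 m) :
    Dense {G : Lp ℝ 2 m | ∃ φ : X → ℝ, Continuous φ ∧ G =ᵐ[m] fun x => φ x * h x} := by
  let _ := TopologicalSpace.upgradeIsCompletelyMetrizable X
  intro g
  rw [EMetric.mem_closure_iff]
  intro ε hε
  set ν := m.withDensity fun x => ENNReal.ofReal (h x ^ 2) with hν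
  have hνf : IsFiniteMeasure ν := by
    refine ⟨?_⟩
    have h3 := h2.2
    have h4 := eLpNorm_two_withDensity_sq (m := m) hm 1
    simp only [Pi.one_apply, one_mul] at h4
    rw [← h4, ← hν] at h3
    rw [eLpNorm_lt_top_iff_lintegral_rpow_enorm_lt_top two_ne_zero ENNReal.ofNat_ne_top] at h3
    simpa using h3
  have hgh : MemLp (fun x => g x / h x) 2 ν := by
    refine ⟨?_, ?_⟩
    · exact ((Lp.stronglyMeasurable g).measurable.div hm).aestronglyMeasurable
    · rw [eLpNorm_two_withDensity_sq hm]
      have : (fun x => g x / h x * h x) = g := funext fun x => div_mul_cancel₀ _ (h0 x).ne'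
      rw [this]
      exact (Lp.memLp g).2
  obtain ⟨ε', hε'0, hε'⟩ := exists_between hε
  obtain ⟨φ, hφ, hφν⟩ := hgh.exists_boundedContinuous_eLpNorm_sub_le ENNReal.ofNat_ne_top hε'0.ne'
  have hφh : MemLp (fun x => φ x * h x) 2 m := by
    refine ⟨(φ.continuous.measurable.mul hm).aestronglyMeasurable, ?_⟩
    rw [← eLpNorm_two_withDensity_sq hm]
    exact hφν.2
  refine ⟨hφh.toLp _, ⟨φ, φ.continuous, hφh.coeFn_toLp⟩, lt_of_le_of_lt ?_ hε'⟩
  rw [Lp.edist_def]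
  calc eLpNorm ((g : X → ℝ) - (hφh.toLp (fun x => φ x * h x) : X → ℝ)) 2 m
      = eLpNorm (fun x => (g x / h x - φ x) * h x) 2 m := by
        refine eLpNorm_congr_ae ?_
        filter_upwards [hφh.coeFn_toLp] with x hx
        rw [Pi.sub_apply, hx, sub_mul, div_mul_cancel₀ _ (h0 x).ne']
    _ = eLpNorm ((fun x => g x / h x) - (φ : X → ℝ)) 2 ν := by
        rw [hν, eLpNorm_two_withDensity_sq hm]
        simp only [Pi.sub_apply]
    _ ≤ ε' := hφ

end Weighted

/-! ### Identification of the trace at time `0` -/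

section Initial

variable {X : Type*} [TopologicalSpace X] [PolishSpace X] [MeasurableSpace X] [BorelSpace X]
  {m : Measure X} {T : ℝ} (hT : 0 < T)
  [MeasurableSpace C(Icc (0 : ℝ) T, X)] [BorelSpace C(Icc (0 : ℝ) T, X)]
  {η : Measure C(Icc (0 : ℝ) T, X)} {c : ℝ≥0}
  {hc : ∀ t : Icc (0 : ℝ) T, η.map (evalAt t) ≤ (c : ℝ≥0∞) • m}
  {L : Lp ℝ 2 m →L[ℝ] C(Icc (0 : ℝ) T, Lp ℝ 2 η)}

/-- Pointwise continuous relations between functions are inherited, at the initial time, by their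
images. -/
theorem initial_relation
    (hL : ∀ᵐ t ∂(volume.restrict (Ioo 0 T)), ∀ g, L g (projIcc 0 T hT.le t) = evalOp hT hc t g)
    {Φ : X × ℝ → ℝ} (hΦ : Continuous Φ) {g G : Lp ℝ 2 m} (hG : G =ᵐ[m] fun x => Φ (x, g x)) :
    L G (time0 hT) =ᵐ[η] fun γ => Φ (γ (time0 hT), L g (time0 hT) γ) := by
  -- Along good times `s n → 0` the relation holds literally. A common subsequence makes both traces
  -- converge a.e., and `γ (s n) → γ 0` by continuity of the curve.
  obtain ⟨s, hs, hs0⟩ := mem_closure_iff_seq_limit.1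
    (mem_closure_of_ae hT hL (left_mem_Icc.2 hT.le))
  have hp : Tendsto (fun n => projIcc 0 T hT.le (s n)) atTop (𝓝 (time0 hT)) := by
    have := (continuous_projIcc (h := hT.le)).tendsto 0 |>.comp hs0
    rwa [projIcc_left] at this
  have hlim : ∀ f : Lp ℝ 2 m, Tendsto (fun n => L f (projIcc 0 T hT.le (s n))) atTop
      (𝓝 (L f (time0 hT))) := fun f => ((L f).continuous.tendsto _).comp hp
  obtain ⟨n₁, hn₁, h₁⟩ := exists_subseq_tendsto_ae (hlim G)
  obtain ⟨n₂, hn₂, h₂⟩ := exists_subseq_tendsto_ae ((hlim g).comp hn₁.tendsto_atTop)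
  have heq : ∀ᵐ γ ∂η, ∀ n, L G (projIcc 0 T hT.le (s n)) γ =
      Φ (γ (projIcc 0 T hT.le (s n)), L g (projIcc 0 T hT.le (s n)) γ) := by
    rw [ae_all_iff]
    intro n
    rw [(hs n).2 G, (hs n).2 g]
    filter_upwards [coeFn_evalOp hT hc (s n) G, coeFn_evalOp hT hc (s n) g,
      (quasiMeasurePreserving_of_map_le (measurable_iccExtend hT (s n))
        (map_iccExtend_le hT hc (s n))).ae hG] with γ e1 e2 e3
    rw [e1, e2, e3]
    rfl
  filter_upwards [h₁, h₂, heq] with γ l1 l2 e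
  have hn := hn₁.tendsto_atTop.comp hn₂.tendsto_atTop
  have l3 := l1.comp hn₂.tendsto_atTop
  have l4 : Tendsto (fun i => γ (projIcc 0 T hT.le (s (n₁ (n₂ i))))) atTop
      (𝓝 (γ (time0 hT))) := (γ.continuous.tendsto _).comp (hp.comp hn)
  have l5 := (hΦ.tendsto _).comp (l4.prodMk_nhds l2)
  refine tendsto_nhds_unique l3 (l5.congr fun i => ?_)
  exact (e (n₁ (n₂ i))).symm

/-- The value at time `0` of the strongly continuous family is the composition with `γ_0`, provided
that dual densities which vanish at time `0` vanish at every time. -/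
theorem flowOp_initial_eq [SigmaFinite m] [IsProbabilityMeasure η]
    (hL : ∀ᵐ t ∂(volume.restrict (Ioo 0 T)), ∀ g, L g (projIcc 0 T hT.le t) = evalOp hT hc t g)
    (huniq : ∀ W : Lp ℝ 2 η, (∀ᵐ γ ∂η, 0 ≤ W γ ∧ W γ ≤ 1) →
      dualDensity L W (time0 hT) = 0 → ∀ t, dualDensity L W t = 0) (g : Lp ℝ 2 m) :
    L g (time0 hT) = evalOp hT hc 0 g := by
  obtain ⟨h, hm, h0, h1, h2⟩ := exists_pos_memLp_two m
  set H : Lp ℝ 2 m := h2.toLp h with hH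
  have hHe : H =ᵐ[m] h := h2.coeFn_toLp
  set θ : Lp ℝ 2 η := L H (time0 hT) with hθ
  have hγ0 : ∀ γ : C(Icc (0 : ℝ) T, X), IccExtend hT.le γ 0 = γ (time0 hT) := fun γ =>
    IccExtend_left _ _
  have hqm := quasiMeasurePreserving_of_map_le (measurable_iccExtend (X := X) hT 0)
    (map_iccExtend_le hT hc 0)
  -- For `g = φ h` with `φ` continuous, the trace is `φ(γ_0) θ`, which gives the identity; density
  -- of such products extends it to all `g`. Thus every trace is determined by `θ` and `γ_0`.
  have hmod : ∀ g : Lp ℝ 2 m, ∀ᵐ γ ∂η,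
      h (γ (time0 hT)) * L g (time0 hT) γ = θ γ * evalOp hT hc 0 g γ := by
    intro g
    obtain ⟨G, hG, hGg⟩ := mem_closure_iff_seq_limit.1 (dense_continuous_mul hm h0 h2 g)
    have hcl : Tendsto (fun n => L (G n) (time0 hT)) atTop (𝓝 (L g (time0 hT))) :=
      (((continuous_eval_const (time0 hT)).comp L.continuous).tendsto g).comp hGg
    have hce : Tendsto (fun n => evalOp hT hc 0 (G n)) atTop (𝓝 (evalOp hT hc 0 g)) :=
      ((evalOp hT hc 0).continuous.tendsto g).comp hGg
    obtain ⟨n₁, hn₁, l₁⟩ := exists_subseq_tendsto_ae hcl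
    obtain ⟨n₂, hn₂, l₂⟩ := exists_subseq_tendsto_ae (hce.comp hn₁.tendsto_atTop)
    have heq : ∀ᵐ γ ∂η, ∀ n, h (γ (time0 hT)) * L (G n) (time0 hT) γ =
        θ γ * evalOp hT hc 0 (G n) γ := by
      rw [ae_all_iff]
      intro n
      obtain ⟨φ, hφ, hφG⟩ := hG n
      have hrel := initial_relation hT hL (Φ := fun p => φ p.1 * p.2)
        ((hφ.comp continuous_fst).mul continuous_snd) (g := H) (G := G n) (by
          filter_upwards [hφG, hHe] with x e1 e2
          rw [e1, e2])
      filter_upwards [hrel, coeFn_evalOp hT hc 0 (G n), hqm.ae hφG] with γ e1 e2 e3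
      rw [e1, e2, e3, hγ0, ← hθ]
      ring
    filter_upwards [l₁, l₂, heq] with γ l1 l2 e
    refine tendsto_nhds_unique ((l1.comp hn₂.tendsto_atTop).const_mul (h (γ (time0 hT))))
      ((l2.const_mul (θ γ)).congr fun i => ?_)
    exact (e (n₁ (n₂ i))).symm
  have h22 : MemLp (fun x => h x * h x) 2 m := by
    refine h2.mono (hm.mul hm).aestronglyMeasurable (ae_of_all _ fun x => ?_)
    rw [norm_mul, Real.norm_of_nonneg (h0 x).le]
    exact mul_le_of_le_one_left (h0 x).le (h1 x)
  -- The trace of `h²` is `θ²` by continuity of the square and `θ h(γ_0)` by `hmod`; hence `θ` is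
  -- either `0` or `h(γ_0)`.
  have hsq : ∀ᵐ γ ∂η, θ γ * θ γ = θ γ * h (γ (time0 hT)) := by
    have hrel := initial_relation hT hL (Φ := fun p => p.2 * p.2)
      (continuous_snd.mul continuous_snd) (g := H) (G := h22.toLp _) (by
        filter_upwards [h22.coeFn_toLp, hHe] with x e1 e2
        rw [e1, e2])
    filter_upwards [hrel, hmod (h22.toLp _), coeFn_evalOp hT hc 0 (h22.toLp _),
      hqm.ae h22.coeFn_toLp] with γ e1 e2 e3 e4
    rw [e1, e3, e4, hγ0, ← hθ] at e2
    refine mul_left_cancel₀ (h0 (γ (time0 hT))).ne' ?_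
    linarith
  have hzero : ∀ᵐ γ ∂η, θ γ ≠ 0 := by
    set S : Set C(Icc (0 : ℝ) T, X) := {γ | θ γ = 0} with hS
    have hSm : MeasurableSet S :=
      (Lp.stronglyMeasurable θ).measurable (measurableSet_singleton 0)
    set W : Lp ℝ 2 η := indicatorConstLp 2 hSm (measure_ne_top η S) 1 with hW
    have hWe : W =ᵐ[η] S.indicator fun _ => (1 : ℝ) := indicatorConstLp_coeFn
    have hW01 : ∀ᵐ γ ∂η, 0 ≤ W γ ∧ W γ ≤ 1 := by
      filter_upwards [hWe] with γ e
      rw [e]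
      by_cases hγ : γ ∈ S <;> simp [hγ]
    -- On `S` all traces vanish, so the weight `1_S` starts from density zero. By `huniq` it then
    -- has density zero at some good time `s`, where `h(γ_s) > 0` forces `η(S) = 0`.
    have hd0 : dualDensity L W (time0 hT) = 0 := by
      refine ext_inner_left ℝ fun f => ?_
      rw [inner_dualDensity, inner_zero_right, L2.inner_def]
      refine integral_eq_zero_of_ae ?_
      filter_upwards [hmod f, hWe] with γ e1 e2
      rw [e2]
      by_cases hγ : γ ∈ S
      · have hθ0 : θ γ = 0 := hγ
        rw [hθ0, zero_mul] at e1
        simp [(mul_eq_zero.1 e1).resolve_left (h0 _).ne']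
      · simp [hγ]
    have hall := huniq W hW01 hd0
    obtain ⟨s, -, -, hs⟩ := mem_closure_iff_nhds.1
      (mem_closure_of_ae hT hL (left_mem_Icc.2 hT.le)) univ univ_mem
    have hin : ⟪evalOp hT hc s H, W⟫_ℝ = 0 := by
      rw [← hs H, ← inner_dualDensity, hall, inner_zero_right]
    have hpt : ∀ᵐ γ ∂η, ⟪evalOp hT hc s H γ, W γ⟫_ℝ = h (IccExtend hT.le γ s) * W γ := by
      filter_upwards [coeFn_evalOp hT hc s H, (quasiMeasurePreserving_of_map_le
        (measurable_iccExtend (X := X) hT s) (map_iccExtend_le hT hc s)).ae hHe] with γ e1 e2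
      rw [e1, e2, RCLike.inner_apply, conj_trivial, mul_comm]
    rw [L2.inner_def, integral_eq_zero_iff_of_nonneg_ae _ (L2.integrable_inner _ _)] at hin
    · filter_upwards [hin, hpt, hWe] with γ e1 e2 e3 hθ0
      have hγS : γ ∈ S := hθ0
      rw [e2, e3, indicator_of_mem hγS, mul_one] at e1
      exact (h0 _).ne' e1
    · filter_upwards [hpt, hW01] with γ e1 e2
      rw [e1]
      exact mul_nonneg (h0 _).le e2.1
  ext1
  filter_upwards [hzero, hsq, hmod g] with γ e1 e2 e3
  have e4 := mul_left_cancel₀ e1 e2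
  rw [e4] at e3
  exact mul_left_cancel₀ (h0 _).ne' e3

end Initial


/-! ### Dirac masses -/

/-- A probability measure giving mass `0` or `1` to each set of a countable family of measurable
sets which separates points is a Dirac mass. -/
theorem exists_eq_dirac {Ω ι : Type*} [MeasurableSpace Ω] [Countable ι] {S : ι → Set Ω}
    (hsep : ∀ γ γ', (∀ i, γ ∈ S i ↔ γ' ∈ S i) → γ = γ') {μ : Measure Ω} [IsProbabilityMeasure μ]
    (hS : ∀ i, MeasurableSet (S i)) (h : ∀ i, μ (S i) = 0 ∨ μ (S i) = 1) :
    ∃ γ, μ = Measure.dirac γ := by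
  have hae : ∀ᵐ γ ∂μ, ∀ i, γ ∈ S i ↔ μ (S i) = 1 := by
    rw [ae_all_iff]
    intro i
    rcases h i with h0 | h1
    · have : ∀ᵐ γ ∂μ, γ ∉ S i := measure_eq_zero_iff_ae_notMem.1 h0
      filter_upwards [this] with γ hγ
      simp [hγ, h0]
    · have : ∀ᵐ γ ∂μ, γ ∈ S i := (prob_compl_eq_zero_iff (hS i)).2 h1
      filter_upwards [this] with γ hγ
      simp [hγ, h1]
  obtain ⟨γ₀, hγ₀⟩ := hae.exists
  have heq : ∀ᵐ γ ∂μ, γ = γ₀ := by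
    filter_upwards [hae] with γ hγ
    exact hsep _ _ fun i => (hγ i).trans (hγ₀ i).symm
  refine ⟨γ₀, Measure.ext fun s hs => ?_⟩
  rw [Measure.dirac_apply' _ hs]
  by_cases h0 : γ₀ ∈ s
  · rw [indicator_of_mem h0, Pi.one_apply, ← prob_compl_eq_zero_iff hs]
    filter_upwards [heq] with γ hγ
    rwa [hγ]
  · rw [indicator_of_notMem h0, measure_eq_zero_iff_ae_notMem]
    filter_upwards [heq] with γ hγ
    rwa [hγ]

theorem measurable_evalAt {X : Type*} [TopologicalSpace X] [MeasurableSpace X] [BorelSpace X] {T : ℝ} [MeasurableSpace C(Icc (0 : ℝ) T, X)]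
    [BorelSpace C(Icc (0 : ℝ) T, X)] (t : Icc (0 : ℝ) T) : Measurable (evalAt (X := X) t) :=
  (continuous_eval_const t).measurable

/-! ### Zero-one law for the conditional measures -/

section ZeroOne

variable {X : Type*} [TopologicalSpace X] [PolishSpace X] [MeasurableSpace X] [BorelSpace X]
  {m : Measure X} {T : ℝ} (hT : 0 < T)
  [MeasurableSpace C(Icc (0 : ℝ) T, X)] [BorelSpace C(Icc (0 : ℝ) T, X)]
  {η : Measure C(Icc (0 : ℝ) T, X)} {c : ℝ≥0}
  {hc : ∀ t : Icc (0 : ℝ) T, η.map (evalAt t) ≤ (c : ℝ≥0∞) • m}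
  {L : Lp ℝ 2 m →L[ℝ] C(Icc (0 : ℝ) T, Lp ℝ 2 η)}

/-- The conditional probabilities of the events `γ_t ∈ E` given `γ_0` are `0` or `1`, whenever the
evolution at time `t` of a weight depends only on its initial conditional expectation. -/
theorem kernel_zero_or_one [SigmaFinite m] [IsProbabilityMeasure η]
    {κ : Kernel X C(Icc (0 : ℝ) T, X)} (hκ : IsDisintegration hT η κ)
    (huniq : ∀ W₁ W₂ : Lp ℝ 2 η, (∀ᵐ γ ∂η, 0 ≤ W₁ γ ∧ W₁ γ ≤ 1) →
      (∀ᵐ γ ∂η, 0 ≤ W₂ γ ∧ W₂ γ ≤ 1) →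
      dualDensity L W₁ (time0 hT) = dualDensity L W₂ (time0 hT) →
        ∀ t, dualDensity L W₁ t = dualDensity L W₂ t)
    (hL0 : ∀ g, L g (time0 hT) = evalOp hT hc 0 g)
    {t : ℝ} (ht : ∀ g, L g (projIcc 0 T hT.le t) = evalOp hT hc t g)
    {E : Set X} (hE : MeasurableSet E) :
    ∀ᵐ x ∂(η.map (evalAt (time0 hT))),
      κ x {γ | IccExtend hT.le γ t ∈ E} = 0 ∨ κ x {γ | IccExtend hT.le γ t ∈ E} = 1 := by
  obtain ⟨hprob, hbind, hfib⟩ := hκ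
  set ν := η.map (evalAt (time0 hT)) with hν
  have he0 := measurable_evalAt (X := X) (time0 hT)
  set S : Set C(Icc (0 : ℝ) T, X) := {γ | IccExtend hT.le γ t ∈ E} with hS
  have hSm : MeasurableSet S := measurable_iccExtend hT t hE
  have hpm : Measurable fun x => (κ x).real S := (κ.measurable_coe hSm).ennreal_toReal
  have hp0 : ∀ x, 0 ≤ (κ x).real S := fun x => measureReal_nonneg
  have hp1 : ∀ x, (κ x).real S ≤ 1 := fun x => measureReal_le_one
  have hpL : MemLp (fun γ : C(Icc (0 : ℝ) T, X) => (κ (γ (time0 hT))).real S) 2 η :=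
    MemLp.of_bound (hpm.comp he0).aestronglyMeasurable 1 (ae_of_all _ fun γ => by
      rw [Real.norm_of_nonneg (hp0 _)]; exact hp1 _)
  have hγ0 : ∀ γ : C(Icc (0 : ℝ) T, X), IccExtend hT.le γ 0 = γ (time0 hT) := fun γ =>
    IccExtend_left _ _
  set W₁ : Lp ℝ 2 η := indicatorConstLp 2 hSm (measure_ne_top η S) 1 with hW₁
  -- `W₂` is the conditional expectation of `W₁` given `γ_0`, so the two weights have the same
  -- integral against any function of `γ_0`.
  set W₂ : Lp ℝ 2 η := hpL.toLp _ with hW₂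
  have hW₁e : W₁ =ᵐ[η] S.indicator fun _ => (1 : ℝ) := indicatorConstLp_coeFn
  have hW₂e : W₂ =ᵐ[η] fun γ => (κ (γ (time0 hT))).real S := hpL.coeFn_toLp
  have hW₁b : ∀ᵐ γ ∂η, 0 ≤ W₁ γ ∧ W₁ γ ≤ 1 := by
    filter_upwards [hW₁e] with γ e
    rw [e]
    by_cases hγ : γ ∈ S <;> simp [hγ]
  have hW₂b : ∀ᵐ γ ∂η, 0 ≤ W₂ γ ∧ W₂ γ ≤ 1 := by
    filter_upwards [hW₂e] with γ e
    rw [e]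
    exact ⟨hp0 _, hp1 _⟩
  have hinit : dualDensity L W₁ (time0 hT) = dualDensity L W₂ (time0 hT) := by
    ext1
    refine ae_eq_of_forall_setIntegral_eq_of_sigmaFinite
      (fun s _ hs => integrableOn_of_memLp_two (Lp.memLp _) hs)
      (fun s _ hs => integrableOn_of_memLp_two (Lp.memLp _) hs) fun B hB hB' => ?_
    rw [← L2.inner_indicatorConstLp_one hB hB'.ne, ← L2.inner_indicatorConstLp_one hB hB'.ne,
      inner_dualDensity, inner_dualDensity, hL0, integral_indicator_evalOp hT hc _ 0 hB hB'.ne,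
      integral_indicator_evalOp hT hc _ 0 hB hB'.ne]
    have hBm : MeasurableSet (evalAt (X := X) (time0 hT) ⁻¹' B) := he0 hB
    have e1 : ∫ γ, B.indicator 1 (IccExtend hT.le γ 0) * W₁ γ ∂η =
        η.real (evalAt (time0 hT) ⁻¹' B ∩ S) := by
      rw [← integral_indicator_one (hBm.inter hSm)]
      refine integral_congr_ae ?_
      filter_upwards [hW₁e] with γ e
      rw [e, hγ0]
      by_cases h1 : γ (time0 hT) ∈ B <;> by_cases h2 : γ ∈ S <;>
        simp [h1, h2, evalAt]
    have e2 : ∫ γ, B.indicator 1 (IccExtend hT.le γ 0) * W₂ γ ∂η =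
        ∫ x in B, (κ x).real S ∂ν := by
      rw [hν, ← integral_indicator hB, integral_map he0.aemeasurable
        (hpm.indicator hB).aestronglyMeasurable]
      refine integral_congr_ae ?_
      filter_upwards [hW₂e] with γ e
      rw [e, hγ0]
      by_cases h1 : γ (time0 hT) ∈ B <;> simp [h1, evalAt]
    rw [e1, e2, integral_eq_lintegral_of_nonneg_ae (ae_of_all _ hp0)
      hpm.aestronglyMeasurable, measureReal_def]
    congr 1
    conv_lhs => rw [hbind]
    rw [Measure.bind_apply (hBm.inter hSm) κ.measurable.aemeasurable, ← lintegral_indicator hB]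
    refine lintegral_congr_ae ?_
    filter_upwards [hfib] with x hx
    have hfin : ENNReal.ofReal ((κ x).real S) = κ x S := ofReal_measureReal
    by_cases h1 : x ∈ B
    · rw [indicator_of_mem h1, hfin]
      refine measure_congr ?_
      filter_upwards [hx] with γ hγ
      refine propext ⟨fun h => h.2, fun h => ⟨?_, h⟩⟩
      change evalAt (time0 hT) γ ∈ B
      rwa [hγ]
    · rw [indicator_of_notMem h1, measure_eq_zero_iff_ae_notMem]
      filter_upwards [hx] with γ hγ hγ'
      have h2 : evalAt (time0 hT) γ ∈ B := hγ'.1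
      rw [hγ] at h2
      exact h1 h2
  have hfinal := huniq W₁ W₂ hW₁b hW₂b hinit (projIcc 0 T hT.le t)
  -- Equality of the densities at time `t` is tested on the complement of `E`, where `W₁`
  -- contributes nothing, so the nonnegative `W₂` must vanish there. Spanning sets keep the test
  -- indicators in `L²(m)`.
  have hae : ∀ᵐ γ : C(Icc (0 : ℝ) T, X) ∂η, IccExtend hT.le γ t ∉ E →
      (κ (γ (time0 hT))).real S = 0 := by
    have hn : ∀ᵐ γ : C(Icc (0 : ℝ) T, X) ∂η, ∀ n, IccExtend hT.le γ t ∈ Eᶜ ∩ spanningSets m n →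
        (κ (γ (time0 hT))).real S = 0 := by
      rw [ae_all_iff]
      intro n
      have hB : MeasurableSet (Eᶜ ∩ spanningSets m n) :=
        hE.compl.inter (measurableSet_spanningSets m n)
      have hB' : m (Eᶜ ∩ spanningSets m n) < ∞ :=
        (measure_mono inter_subset_right).trans_lt (measure_spanningSets_lt_top m n)
      have h1 := congrArg (fun v => ⟪indicatorConstLp 2 hB hB'.ne (1 : ℝ), v⟫_ℝ) hfinal
      simp only [inner_dualDensity, ht] at h1
      rw [integral_indicator_evalOp hT hc _ t hB hB'.ne,
        integral_indicator_evalOp hT hc _ t hB hB'.ne] at h1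
      have h2 : ∫ γ, (Eᶜ ∩ spanningSets m n).indicator 1 (IccExtend hT.le γ t) * W₁ γ ∂η = 0 := by
        refine integral_eq_zero_of_ae ?_
        filter_upwards [hW₁e] with γ e
        rw [e]
        by_cases h3 : IccExtend hT.le γ t ∈ E <;> simp [h3, hS]
      rw [h2] at h1
      have hint : Integrable (fun γ : C(Icc (0 : ℝ) T, X) => (Eᶜ ∩ spanningSets m n).indicator 1
          (IccExtend hT.le γ t) * W₂ γ) η := by
        refine Integrable.bdd_mul (c := 1) ((Lp.memLp W₂).integrable one_le_two)
          ((measurable_one.indicator hB).comp (measurable_iccExtend hT t)).aestronglyMeasurable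
          (ae_of_all _ fun γ => ?_)
        by_cases h3 : IccExtend hT.le γ t ∈ Eᶜ ∩ spanningSets m n
        · simp [indicator_of_mem h3]
        · simp [indicator_of_notMem h3]
      have h4 := (integral_eq_zero_iff_of_nonneg_ae (by
        filter_upwards [hW₂b] with γ hγ
        exact mul_nonneg (indicator_nonneg (fun _ _ => zero_le_one) _) hγ.1) hint).1 h1.symm
      filter_upwards [h4, hW₂e] with γ e1 e2 h5
      rw [indicator_of_mem h5, e2] at e1
      simpa using e1
    filter_upwards [hn] with γ hγ hγE
    obtain ⟨n, hn⟩ := mem_iUnion.1 ((iUnion_spanningSets m).symm ▸ mem_univ (IccExtend hT.le γ t))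
    exact hγ n ⟨hγE, hn⟩
  rw [hbind] at hae
  filter_upwards [Measure.ae_ae_of_ae_bind κ.measurable.aemeasurable hae, hfib] with x h1 h2
  have := hprob x
  -- On the fibre over `x` the number in `hae` is the constant `κ x S`; if it is nonzero, then a.e.
  -- curve of the fibre lies in `S`.
  by_cases h0 : (κ x).real S = 0
  · left
    exact (measureReal_eq_zero_iff).1 h0
  · right
    rw [← prob_compl_eq_zero_iff hSm]
    filter_upwards [h1, h2] with γ h3 h4
    by_contra h5
    refine h0 ?_
    have h6 := h3 h5
    have h7 : γ (time0 hT) = x := h4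
    rwa [h7] at h6

/-- Under the zero-one law at a.e. time, the conditional measures are Dirac masses. -/
theorem ae_exists_eq_dirac {κ : Kernel X C(Icc (0 : ℝ) T, X)} [∀ x, IsProbabilityMeasure (κ x)]
    {ν : Measure X}
    (h : ∀ᵐ t ∂(volume.restrict (Ioo 0 T)), ∀ E : Set X, MeasurableSet E → ∀ᵐ x ∂ν,
      κ x {γ | IccExtend hT.le γ t ∈ E} = 0 ∨ κ x {γ | IccExtend hT.le γ t ∈ E} = 1) :
    ∀ᵐ x ∂ν, ∃ γ, κ x = Measure.dirac γ := by
  set D : Set ℝ := {s | s ∈ Ioo 0 T ∧ ∀ E : Set X, MeasurableSet E → ∀ᵐ x ∂ν,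
      κ x {γ | IccExtend hT.le γ s ∈ E} = 0 ∨ κ x {γ | IccExtend hT.le γ s ∈ E} = 1} with hD
  -- The countable set of times has to lie inside the good set `D`, which may miss any prescribed
  -- countable set.
  obtain ⟨Q, hQD, hQc, hQd⟩ :=
    (TopologicalSpace.IsSeparable.of_separableSpace D).exists_countable_dense_subset
  have hQI : ∀ t ∈ Icc 0 T, t ∈ closure Q := fun t ht =>
    closure_minimal hQd isClosed_closure (mem_closure_of_ae hT h ht)
  have : Countable Q := hQc.to_subtype
  have : Countable (TopologicalSpace.countableBasis X) :=
    (TopologicalSpace.countable_countableBasis X).to_subtype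
  let S : Q × TopologicalSpace.countableBasis X → Set C(Icc (0 : ℝ) T, X) := fun i =>
    {γ | IccExtend hT.le γ i.1 ∈ (i.2 : Set X)}
  have hbm : ∀ E : TopologicalSpace.countableBasis X, MeasurableSet (E : Set X) := fun E =>
    (TopologicalSpace.isOpen_of_mem_countableBasis E.2).measurableSet
  have hall : ∀ᵐ x ∂ν, ∀ i, κ x (S i) = 0 ∨ κ x (S i) = 1 := by
    rw [ae_all_iff]
    exact fun i => (hQD i.1.2).2 _ (hbm i.2)
  filter_upwards [hall] with x hx
  refine exists_eq_dirac (S := S) (fun γ γ' hγ => ?_)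
    (fun i => measurable_iccExtend hT _ (hbm i.2)) hx
  have hq : ∀ q ∈ Q, IccExtend hT.le γ q = IccExtend hT.le γ' q := by
    intro q hq
    let _ := TopologicalSpace.upgradeIsCompletelyMetrizable X
    refine (TopologicalSpace.isBasis_countableBasis X).inseparable_iff.2 (fun E hE => ?_) |>.eq
    exact hγ (⟨q, hq⟩, ⟨E, hE⟩)
  ext t
  have hcl : IsClosed {s | IccExtend hT.le γ s = IccExtend hT.le γ' s} :=
    isClosed_eq (γ.continuous.Icc_extend') (γ'.continuous.Icc_extend')
  have : IccExtend hT.le γ t = IccExtend hT.le γ' t :=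
    closure_minimal (s := Q) hq hcl (hQI t t.2)
  simpa using this

end ZeroOne

/-! ### Existence of conditional measures and Borel selection -/

section Disintegration

variable {X : Type*} [TopologicalSpace X] [PolishSpace X] [MeasurableSpace X] [BorelSpace X]
  {T : ℝ} (hT : 0 < T)
  [MeasurableSpace C(Icc (0 : ℝ) T, X)] [BorelSpace C(Icc (0 : ℝ) T, X)]
  (η : Measure C(Icc (0 : ℝ) T, X))

theorem exists_isDisintegration [IsProbabilityMeasure η] : ∃ κ : Kernel X C(Icc (0 : ℝ) T, X),
    IsDisintegration hT η κ := by
  have : Nonempty C(Icc (0 : ℝ) T, X) := nonempty_of_isProbabilityMeasure η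
  have he0 := measurable_evalAt (X := X) (time0 hT)
  refine ⟨condDistrib id (evalAt (time0 hT)) η, fun x => inferInstance, ?_, ?_⟩
  · rw [condDistrib_comp_map he0.aemeasurable aemeasurable_id, Measure.map_id]
  · refine Measure.ae_ae_of_ae_compProd (p := fun p : X × C(Icc (0 : ℝ) T, X) =>
      evalAt (time0 hT) p.2 = p.1) ?_
    rw [compProd_map_condDistrib aemeasurable_id]
    exact (ae_map_iff (he0.prodMk measurable_id).aemeasurable
      (measurableSet_eq_fun (he0.comp measurable_snd) measurable_fst)).2 (ae_of_all _ fun _ => rfl)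

/-- If the conditional measures are Dirac masses, they are induced by a Borel map selecting, for
each point, a curve starting from it. -/
theorem exists_selection {κ : Kernel X C(Icc (0 : ℝ) T, X)} (hκ : IsDisintegration hT η κ)
    (hd : ∀ᵐ x ∂(η.map (evalAt (time0 hT))), ∃ γ, κ x = Measure.dirac γ) :
    ∃ S : X → C(Icc (0 : ℝ) T, X), Measurable S ∧ (∀ x, evalAt (time0 hT) (S x) = x) ∧
      η = (η.map (evalAt (time0 hT))).bind (fun x => Measure.dirac (S x)) := by
  classical
  obtain ⟨hprob, hbind, hfib⟩ := hκ
  set ν := η.map (evalAt (time0 hT)) with hν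
  have hgood : ∀ᵐ x ∂ν, ∃ γ, κ x = Measure.dirac γ ∧ evalAt (time0 hT) γ = x := by
    filter_upwards [hd, hfib] with x ⟨γ, hγ⟩ h2
    refine ⟨γ, hγ, ?_⟩
    rw [hγ, ae_dirac_eq] at h2
    exact h2
  -- The bad set is enlarged to a Borel null set so that switching to constant curves on it keeps
  -- the selection Borel.
  obtain ⟨N, hNsub, hNm, hN0⟩ := exists_measurable_superset_of_null hgood
  have hN : ∀ x, x ∉ N → ∃ γ, κ x = Measure.dirac γ ∧ evalAt (time0 hT) γ = x := fun x hx => by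
    by_contra h
    exact hx (hNsub h)
  choose S₀ hS₀ hS₀x using hN
  let S : X → C(Icc (0 : ℝ) T, X) := fun x =>
    if h : x ∉ N then S₀ x h else ContinuousMap.const _ x
  have hSpos : ∀ x (h : x ∉ N), S x = S₀ x h := fun x h => dif_pos h
  have hSneg : ∀ x, x ∈ N → S x = ContinuousMap.const _ x := fun x h =>
    dif_neg (not_not.2 h)
  have hconst : Measurable fun x : X => ContinuousMap.const (Icc (0 : ℝ) T) x :=
    ContinuousMap.continuous_const'.measurable
  have hSm : Measurable S := by
    intro B hB
    -- Off `N` the pointwise choice is unique: `S x ∈ B` exactly when `κ x B = 1`, so Borel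
    -- measurability comes from the kernel.
    have : S ⁻¹' B = (Nᶜ ∩ {x | κ x B = 1}) ∪
        (N ∩ (fun x : X => ContinuousMap.const (Icc (0 : ℝ) T) x) ⁻¹' B) := by
      ext x
      by_cases hx : x ∈ N
      · simp [hx, hSneg x hx]
      · have h1 : κ x B = 1 ↔ S₀ x hx ∈ B := by
          rw [hS₀ x hx, Measure.dirac_apply' _ hB]
          by_cases h : S₀ x hx ∈ B <;> simp [h]
        simp [hx, hSpos x hx, h1]
    rw [this]
    exact (hNm.compl.inter (κ.measurable_coe hB (measurableSet_singleton 1))).union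
      (hNm.inter (hconst hB))
  refine ⟨S, hSm, fun x => ?_, ?_⟩
  · by_cases hx : x ∈ N
    · rw [hSneg x hx]; rfl
    · rw [hSpos x hx]; exact hS₀x x hx
  · conv_lhs => rw [hbind]
    have hSd : Measurable fun x => Measure.dirac (S x) := Measure.measurable_dirac.comp hSm
    ext B hB
    rw [Measure.bind_apply hB κ.measurable.aemeasurable, Measure.bind_apply hB hSd.aemeasurable]
    refine lintegral_congr_ae ?_
    filter_upwards [measure_eq_zero_iff_ae_notMem.1 hN0] with x hx
    rw [hSpos x hx, hS₀ x hx]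

end Disintegration

end NoSplitting

/-! ### The no splitting criterion -/

theorem theorem8p4 {X : Type*} [TopologicalSpace X] [PolishSpace X] [MeasurableSpace X]
    [BorelSpace X] (m : Measure X) [SigmaFinite m] [m.IsOpenPosMeasure]
    (𝓔 : NoSplitting.DirichletForm m) (C : NoSplitting.CarreDuChamp 𝓔)
    (A : Submodule ℝ (Lp ℝ 2 m)) (hA : NoSplitting.IsTestAlgebra C A)
    (T : ℝ) (hT : 0 < T)
    (b : ℝ → NoSplitting.Deriv C A) (hb : NoSplitting.FamilyInL1L1Linf T b)
    (hunique : NoSplitting.UniqueInLPlus T b)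
    (R : NoSplitting.BorelRep T b)
    [MeasurableSpace C(Icc (0 : ℝ) T, X)] [BorelSpace C(Icc (0 : ℝ) T, X)]
    (η : Measure C(Icc (0 : ℝ) T, X)) [IsProbabilityMeasure η]
    (hη : NoSplitting.ConcentratedOnSolutions hT R η)
    (hbound : ∃ L₀ : ℝ≥0, ∀ t : Icc (0 : ℝ) T,
      η.map (NoSplitting.evalAt t) ≤ (L₀ : ℝ≥0∞) • m) :
    (∀ κ : Kernel X C(Icc (0 : ℝ) T, X), NoSplitting.IsDisintegration hT η κ →
      ∀ᵐ x ∂(η.map (NoSplitting.evalAt (NoSplitting.time0 hT))),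
        ∃ γ : C(Icc (0 : ℝ) T, X), κ x = Measure.dirac γ) ∧
    (∃ S : X → C(Icc (0 : ℝ) T, X), Measurable S ∧
      (∀ x, NoSplitting.evalAt (NoSplitting.time0 hT) (S x) = x) ∧
      (∀ f : A, ∀ᵐ x ∂(η.map (NoSplitting.evalAt (NoSplitting.time0 hT))),
        NoSplitting.SolvesODE hT R f (S x)) ∧
      η = (η.map (NoSplitting.evalAt (NoSplitting.time0 hT))).bind
        (fun x => Measure.dirac (S x))) := by
  obtain ⟨c, hc⟩ := hbound
  obtain ⟨L, hL, hLA⟩ := NoSplitting.exists_flowOp hT R hA hη hc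
  have huniq := fun W₁ W₂ h₁ h₂ =>
    NoSplitting.dualDensity_eq_of_initial_eq (W₁ := W₁) (W₂ := W₂) hT R hA hb hunique hη hL hLA
      h₁ h₂
  -- Vanishing of a dual density propagates in time by comparing the weight with the zero weight.
  have hL0 := NoSplitting.flowOp_initial_eq hT hL fun W hW h0 t => by
    have hz : ∀ t, NoSplitting.dualDensity L (0 : Lp ℝ 2 η) t = 0 := fun t => map_zero _
    rw [← hz t]
    refine huniq W 0 hW ?_ (h0.trans (hz _).symm) t
    filter_upwards [Lp.coeFn_zero ℝ 2 η] with γ hγ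
    rw [hγ]
    exact ⟨le_rfl, zero_le_one⟩
  have hdirac : ∀ κ : Kernel X C(Icc (0 : ℝ) T, X), NoSplitting.IsDisintegration hT η κ →
      ∀ᵐ x ∂(η.map (NoSplitting.evalAt (NoSplitting.time0 hT))),
        ∃ γ : C(Icc (0 : ℝ) T, X), κ x = Measure.dirac γ := by
    intro κ hκ
    have := hκ.1
    refine NoSplitting.ae_exists_eq_dirac hT ?_
    filter_upwards [hL] with t ht E hE
    exact NoSplitting.kernel_zero_or_one hT hκ huniq hL0 ht hE
  refine ⟨hdirac, ?_⟩
  obtain ⟨κ, hκ⟩ := NoSplitting.exists_isDisintegration hT η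
  obtain ⟨S, hSm, hSx, hSη⟩ := NoSplitting.exists_selection hT η hκ (hdirac κ hκ)
  refine ⟨S, hSm, hSx, fun f => ?_, hSη⟩
  -- Disintegrating the a.e. statement over the Dirac masses turns it into a statement about `S x`
  -- for a.e. `x`.
  have hf := hη f
  rw [hSη] at hf
  have := Measure.ae_ae_of_ae_bind (Measure.measurable_dirac.comp hSm).aemeasurable hf
  filter_upwards [this] with x hx
  rw [Function.comp_apply, ae_dirac_eq] at hx
  exact hx
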